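/- **Definitions.** All strings are finite. *LZ77.* The LZ77 parse of a string is computed from left to right; each phrase is the longest prefix of the remaining text that also occurs starting at an earlier position (overlaps allowed; possibly empty), followed by one further character (which may be missing at the end of the string). *SLP.* An SLP is a context-free grammar with finitely many nonterminals, exactly one rule for each nonterminal, every right-hand side consisting of one or two symbols, and no nonterminal deriving a string that contains itself; it generates exactly one string. Its size is its number of rules. *Rsync parse.* Fix a window size $w\ge 1$, a hash function $h$ on strings and a number $p$; a string $u$ of length $w$ is *triggering* if $h(u)\equiv 0 \pmod p$. The Rsync parse $P$ of a non-empty string $S$ is its division into consecutive blocks obtained by sliding a window of length $w$ over $S$: the current block is ended at the end of the window as soon as the window contains a triggering string, and then the window is moved ahead by $w$ characters, so that it starts at the beginning of the next block; what remains at the end of $S$ is the last block. A position of $S$ is a *reset point* if a block ended there by a triggering string. The parse of $S$ is *context-triggered* if reset points depend only on the content of the window: whenever $S[i..i+w-1]=S[j..j+w-1]$, there is a reset point right after the first occurrence if and only if there is one right after the second. (This holds, for instance, if no two occurrences of triggering strings in $S$ overlap.) *Rpair.* Let $B_1,\dots,B_b$ be the distinct blocks in order of first appearance and $D=B_1\$_1B_2\$_2\cdots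 B_b\$_b$ with distinct new separator characters $\$_i$; regard $P$ as a string whose characters are the blocks. Given SLPs for $D$ and for $P$, Rpair (1) deletes from the SLP for $D$ all nonterminals that do not occur at least twice in its parse tree, and the separators; (2) lists from left to right the roots of the maximal remaining subtrees of the parse tree (single characters included) and divides the list into $b$ sublists, the $i$-th of which expands to $B_i$; (3) for each $i$ adds $\max(1,\ell_i-1)$ rules (where $\ell_i$ is the length of the $i$-th sublist) with right-hand sides of at most two symbols that generate the $i$-th sublist from a new nonterminal $X_i$; (4) replaces each terminal $B_i$ in the SLP for $P$ by $X_i$, omits its nonterminals that do not occur in its parse tree, and takes the union of all these rules, with the start symbol of the SLP for $P$. **Theorem.** There is an absolute constant $C>0$ such that the following holds. Let $S$ be a non-empty string over any alphabet, with $z$ phrases in its LZ77 parse, and let $w,h,p$ be such that the Rsync parse of $S$ is context-triggered. Let $A$ be any method that builds an SLP for every non-empty string, and let $\alpha$ be a real number such that the SLPs that $A$ builds for $D$ and for $P$ have at most $\alpha$ times as many rules as there are phrases in the LZ77 parses of $D$ and of $P$, respectively. Then Rpair, using these two SLPs, yields an SLP that generates exactly $S$ and has at most $C\alpha z$ rules.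 -/

import Mathlib

universe u v

namespace Rpair

/-! ### The LZ77 parse -/

section LZ77

variable {T : Type u}

/-- The `ℓ` characters of `s` from position `i` on (positions are counted from `0`) also occur in
`s` from some earlier position on; the two occurrences may overlap. -/
def HasEarlierCopy (s : List T) (i ℓ : ℕ) : Prop :=
  i + ℓ ≤ s.length ∧ ∃ j < i, (s.drop j).take ℓ = (s.drop i).take ℓ

open Classical in
/-- The length of the longest substring of `s` starting at position `i` that also occurs from an
earlier position on (`0` if there is none). -/
noncomputable def longestCopy (s : List T) (i : ℕ) : ℕ :=
  Nat.findGreatest (HasEarlierCopy s i) s.length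

/-- The phrases of the LZ77 parse of `s` from position `i` on: each phrase is the longest
substring with an earlier occurrence followed by one further (mismatching) character; at the end
of `s` the further character may be missing. -/
noncomputable def lz77From (s : List T) (i : ℕ) : List (List T) :=
  if i < s.length then
    (s.drop i).take (longestCopy s i + 1) :: lz77From s (i + (longestCopy s i + 1))
  else []
  termination_by s.length - i
  decreasing_by omega

/-- The LZ77 parse of `s`, as the list of its phrases. -/
noncomputable def lz77 (s : List T) : List (List T) := lz77From s 0

/-- The number of phrases of the LZ77 parse of `s`. -/
noncomputable def numPhrases (s : List T) : ℕ := (lz77 s).length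

end LZ77

/-! ### Straight-line programs -/

/-- A grammar symbol: a nonterminal or a terminal. -/
inductive Sym (N : Type v) (T : Type u) where
  | nonterm (X : N) : Sym N T
  | term (t : T) : Sym N T

/-- A context-free grammar over the terminals `T` with finitely many nonterminals, exactly one
rule `X → rule X` for each nonterminal `X`, and a start symbol. -/
structure Grammar (T : Type u) where
  NT : Type
  finite : Finite NT
  rule : NT → List (Sym NT T)
  start : NT

namespace Grammar

variable {T : Type u} (G : Grammar T)

/-- The number of rules. -/
noncomputable def numRules : ℕ := Nat.card G.NT

/-- `Y` occurs on the right-hand side of the rule of `X`. -/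
def Child (Y X : G.NT) : Prop := Sym.nonterm Y ∈ G.rule X

/-- The grammar is a straight-line program: no nonterminal derives itself, and every right-hand
side consists of one or two symbols (terminals or nonterminals). -/
structure IsSLP : Prop where
  acyclic : WellFounded G.Child
  one_le_length : ∀ X, 1 ≤ (G.rule X).length
  length_le_two : ∀ X, (G.rule X).length ≤ 2

end Grammar

/-- A straight-line program over the terminals `T`. -/
structure SLP (T : Type u) extends Grammar T where
  isSLP : toGrammar.IsSLP

namespace SLP

variable {T : Type u} (G : SLP T)

/-- Bottom-up evaluation of the parse tree rooted at a nonterminal: a leaf `t` is evaluated to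
`leaf t`, and an inner node labelled `X` to `node X l`, where `l` is the concatenation, from left
to right, of the values of its children. -/
noncomputable def evalTree {β : Type v} (leaf : T → List β) (node : G.NT → List β → List β) :
    G.NT → List β :=
  G.isSLP.acyclic.fix fun X ih =>
    node X ((G.rule X).attach.flatMap fun s =>
      match s with
      | ⟨Sym.nonterm Y, h⟩ => ih Y h
      | ⟨Sym.term t, _⟩ => leaf t)

theorem evalTree_eq {β : Type v} (leaf : T → List β) (node : G.NT → List β → List β)
    (X : G.NT) :
    G.evalTree leaf node X = node X ((G.rule X).flatMap fun s =>
      match s with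
      | Sym.nonterm Y => G.evalTree leaf node Y
      | Sym.term t => leaf t) := by
  unfold evalTree
  rw [WellFounded.fix_eq]
  congr 1
  conv_rhs => rw [← List.attach_map_subtype_val (G.rule X), List.flatMap_map]
  congr 1
  funext s
  rcases s with ⟨s | s, h⟩ <;> rfl

/-- The string generated by the SLP. -/
noncomputable def expansion : List T :=
  G.evalTree (fun t => [t]) (fun _ l => l) G.start

/-- The labels of the inner nodes of the parse tree of the SLP, in preorder. -/
noncomputable def nodes : List G.NT :=
  G.evalTree (fun _ => []) (fun X l => X :: l) G.start

open Classical in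
/-- The number of occurrences of the nonterminal `X` in the parse tree of the SLP. -/
noncomputable def occ (X : G.NT) : ℕ := G.nodes.count X

open Classical in
/-- The labels, from left to right, of the roots of the maximal subtrees of the parse tree that
remain when all nodes whose label does not satisfy `keep` are removed (leaves are kept). -/
noncomputable def frontier (keep : G.NT → Prop) : List (Sym G.NT T) :=
  G.evalTree (fun t => [Sym.term t])
    (fun X l => if keep X then [Sym.nonterm X] else l) G.start

theorem one_le_occ_start : 1 ≤ G.occ G.start := by
  classical
  unfold occ nodes
  rw [evalTree_eq, Nat.one_le_iff_ne_zero, ← Nat.pos_iff_ne_zero, List.count_pos_iff]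
  exact List.mem_cons_self

end SLP

/-- A method `A` that builds, for each nonempty string over any alphabet, an SLP for it. -/
structure SLPConstruction where
  build : ∀ {T : Type u} (s : List T), s ≠ [] → SLP T
  expansion_build : ∀ {T : Type u} (s : List T) (hs : s ≠ []), (build s hs).expansion = s

/-! ### The Rsync parse -/

/-- The choices made for an Rsync parse: the size `w ≥ 1` of the sliding window, a hash function
and the threshold `p`. -/
structure Rsync (σ : Type u) where
  w : ℕ
  w_pos : 1 ≤ w
  hash : List σ → ℕ
  p : ℕ

section Parse

variable {σ : Type u} (R : Rsync σ)

/-- A triggering substring: a string of length `w` whose hash is congruent to `0` modulo `p`. -/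
def Rsync.Triggering (x : List σ) : Prop := x.length = R.w ∧ R.hash x ≡ 0 [MOD R.p]

open Classical in
/-- The length of the first block of a nonempty string: the window slides over the string, from
its beginning, until it contains a triggering substring, and the block ends where the window ends;
if this never happens the block is the whole string. -/
noncomputable def Rsync.blockLength (x : List σ) : ℕ :=
  match (List.range (x.length + 1 - R.w)).find?
      (fun k => decide (R.Triggering ((x.drop k).take R.w))) with
  | some k => k + R.w
  | none => x.length

theorem Rsync.blockLength_pos {x : List σ} (hx : x ≠ []) : 0 < R.blockLength x := by
  have h1 := R.w_pos
  have h2 := List.length_pos_of_ne_nil hx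
  unfold Rsync.blockLength
  split <;> omega

open Classical in
/-- The Rsync parse of a string, as the list of its blocks. After a block has been ended, the
window is moved to just behind it, so that the next block starts there. -/
noncomputable def Rsync.parse (x : List σ) : List (List σ) :=
  if hx : x = [] then []
  else x.take (R.blockLength x) :: Rsync.parse (x.drop (R.blockLength x))
  termination_by x.length
  decreasing_by
    have h1 := R.blockLength_pos hx
    have h2 := List.length_pos_of_ne_nil hx
    rw [List.length_drop]
    omega

/-- `e` is a reset point of `S`: the Rsync parse of `S` has a block that ends just before position
`e`, and that was ended by a triggering substring. -/
def Rsync.IsReset (S : List σ) (e : ℕ) : Prop :=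
  ∃ (pre : List (List σ)) (B : List σ) (post : List (List σ)),
    R.parse S = pre ++ B :: post ∧ R.w ≤ B.length ∧
    R.Triggering (B.drop (B.length - R.w)) ∧ e = pre.flatten.length + B.length

/-- The parse of `S` is context-triggered: whether there is a reset point behind a window depends
only on the content of the window, and not on the earlier or later parts of `S`. -/
def Rsync.ContextTriggered (S : List σ) : Prop :=
  ∀ i j : ℕ, i + R.w ≤ S.length → j + R.w ≤ S.length →
    (S.drop i).take R.w = (S.drop j).take R.w →
    R.IsReset S (i + R.w) → R.IsReset S (j + R.w)

open Classical in
/-- The Rsync dictionary of `S`: its distinct blocks, in the order of their first appearances.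
(`List.dedup` keeps the last copy of each element, hence the two reversals.) -/
noncomputable def Rsync.dictionary (S : List σ) : List (List σ) :=
  (R.parse S).reverse.dedup.reverse

/-- The dictionary string `D`: the blocks of the dictionary are concatenated, the `i`-th block
being followed by its own separator character `Sum.inr i`. -/
noncomputable def Rsync.dictString (S : List σ) : List (σ ⊕ ℕ) :=
  (R.dictionary S).zipIdx.flatMap fun Bi => Bi.1.map Sum.inl ++ [Sum.inr Bi.2]

theorem Rsync.parse_ne_nil {S : List σ} (hS : S ≠ []) : R.parse S ≠ [] := by
  rw [Rsync.parse, dif_neg hS]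
  exact List.cons_ne_nil _ _

theorem Rsync.dictString_ne_nil {S : List σ} (hS : S ≠ []) : R.dictString S ≠ [] := by
  classical
  have h : R.dictionary S ≠ [] := by
    unfold Rsync.dictionary
    simpa using R.parse_ne_nil hS
  unfold Rsync.dictString
  cases hd : R.dictionary S with
  | nil => exact absurd hd h
  | cons B l => simp

end Parse

/-! ### Algorithm Rpair -/

section Algorithm

variable {σ : Type u}

/-- Is the symbol a separator character? -/
def isSeparator {N : Type v} : Sym N (σ ⊕ ℕ) → Bool
  | Sym.term (Sum.inr _) => true
  | _ => false

/-- The nonterminals of an SLP for the dictionary string that are not deleted: those that occur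
more than once in the parse tree. (Useless nonterminals, which do not occur in the parse tree at
all, are dropped as well.) -/
def Remaining (GD : SLP (σ ⊕ ℕ)) (X : GD.NT) : Prop := 2 ≤ GD.occ X

/-- The roots of the maximal remaining subtrees of the parse tree, divided into sublists: the
`i`-th sublist consists of those between the separator of the previous block and the separator of
the `i`-th block. -/
noncomputable def sublist (GD : SLP (σ ⊕ ℕ)) (i : ℕ) : List (Sym GD.NT (σ ⊕ ℕ)) :=
  ((GD.frontier (Remaining GD)).splitOnP isSeparator).getD i []

/-- The nonterminals of the combined SLP, for an SLP `GD` of the dictionary string, an SLP `GP` of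
the parse, and `b` blocks in the dictionary: the remaining nonterminals of `GD`; new nonterminals
`(i, k)` used to generate the `i`-th sublist; the nonterminals of `GP`. If the `i`-th sublist has
`ℓ` elements, there are `ℓ - 1` new nonterminals for it (one if `ℓ = 1`). -/
abbrev CombinedNT (GD : SLP (σ ⊕ ℕ)) (GP : SLP (List σ)) (b : ℕ) : Type :=
  {X : GD.NT // Remaining GD X} ⊕ (Σ i : Fin b, Fin ((sublist GD i).length - 2 + 1)) ⊕
    {Y : GP.NT // 1 ≤ GP.occ Y}

/-- The nonterminal `X_i`, which generates the `i`-th block. -/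
noncomputable def blockNT (GD : SLP (σ ⊕ ℕ)) (GP : SLP (List σ)) {b : ℕ} (i : Fin b) : CombinedNT GD GP b :=
  Sum.inr (Sum.inl ⟨i, 0⟩)

open Classical in
/-- A symbol of `GD` in the combined SLP; deleted nonterminals and separators are left out. -/
noncomputable def dictSym (GD : SLP (σ ⊕ ℕ)) (GP : SLP (List σ)) (b : ℕ) :
    Sym GD.NT (σ ⊕ ℕ) → Option (Sym (CombinedNT GD GP b) σ)
  | Sym.nonterm X =>
      if h : Remaining GD X then some (Sym.nonterm (Sum.inl ⟨X, h⟩)) else none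
  | Sym.term (Sum.inl a) => some (Sym.term a)
  | Sym.term (Sum.inr _) => none

open Classical in
/-- A symbol of `GP` in the combined SLP: the terminal for the `i`-th block of the dictionary is
replaced by `X_i`. (Nonterminals that do not occur in the parse tree of `GP`, and terminals that
are not blocks, are irrelevant and left out.) -/
noncomputable def parseSym (GD : SLP (σ ⊕ ℕ)) (GP : SLP (List σ)) (dict : List (List σ)) :
    Sym GP.NT (List σ) → Option (Sym (CombinedNT GD GP dict.length) σ)
  | Sym.nonterm Y =>
      if h : 1 ≤ GP.occ Y then some (Sym.nonterm (Sum.inr (Sum.inr ⟨Y, h⟩))) else none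
  | Sym.term B =>
      if h : dict.idxOf B < dict.length then
        some (Sym.nonterm (blockNT GD GP ⟨dict.idxOf B, h⟩))
      else none

/-- The combination of an SLP `GD` for the dictionary string with an SLP `GP` for the parse. The
`i`-th sublist `s₀ s₁ … s_{ℓ-1}` is generated from `X_i = (i, 0)` by the rules
`(i, k) → s_k (i, k + 1)` for `k < ℓ - 2` and `(i, ℓ - 2) → s_{ℓ-2} s_{ℓ-1}` (if `ℓ = 1`, by the
rule `(i, 0) → s₀`). -/
noncomputable def combine (GD : SLP (σ ⊕ ℕ)) (GP : SLP (List σ)) (dict : List (List σ)) :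
    Grammar σ where
  NT := CombinedNT GD GP dict.length
  finite := by
    have := GD.finite
    have := GP.finite
    infer_instance
  rule
    | Sum.inl X => (GD.rule X.1).filterMap (dictSym GD GP dict.length)
    | Sum.inr (Sum.inl ⟨i, k⟩) =>
        let rest := ((sublist GD i).drop k).filterMap (dictSym GD GP dict.length)
        if h : (k : ℕ) + 1 < (sublist GD i).length - 2 + 1 then
          rest.take 1 ++ [Sym.nonterm (Sum.inr (Sum.inl ⟨i, ⟨k + 1, h⟩⟩))]
        else rest
    | Sum.inr (Sum.inr Y) => (GP.rule Y.1).filterMap (parseSym GD GP dict)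
  start := Sum.inr (Sum.inr ⟨GP.start, GP.one_le_occ_start⟩)

/-- Algorithm Rpair applied to `S`, with the construction `A` being used to build the SLPs for the
dictionary string `D` and for the parse `P` (a string whose characters are the blocks). -/
noncomputable def rpair (A : SLPConstruction.{u}) (R : Rsync σ) (S : List σ) (hS : S ≠ []) :
    Grammar σ :=
  combine (A.build (R.dictString S) (R.dictString_ne_nil hS))
    (A.build (R.parse S) (R.parse_ne_nil hS)) (R.dictionary S)

end Algorithm

end Rpair

namespace Rpair

/-! ### Earlier copies, marked positions and phrase counts -/

section LZ77

variable {T : Type u}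

/-! The sizes of the LZ77 parses of `P` and `D` are both linear in `z`, and Rpair costs at most one
rule more than the two given SLPs together; with `α` these two facts give the bound.

Phrase counts are compared through marked positions. The last positions of the `z` phrases of `S`
meet every substring that has no earlier copy. Conversely, if every substring avoiding a set `M`
splits into two pieces with earlier copies, then two consecutive phrases cannot both avoid `M`, so
there are at most `2 |M| + 2` phrases (`numPhrases_le`).

For `P`, context-triggering makes a copy of some blocks together with the preceding window parse
into the same blocks, so `O(z)` marked blocks suffice (`exists_finset_parse`). The first occurrence
of each distinct block must be marked, hence `D` has `O(z)` separators. A substring inside a block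
of `D` is traced to the first occurrence of that block in `S`. If it has an earlier copy there, at
most one block boundary cuts that copy: a second one would have a full window inside the copy and so
force a reset inside the original block. This yields two pieces with earlier copies in `D`
(`split_dictString`).

On the grammar side, each separator occurs once, so no nonterminal occurring twice derives one, and
cutting the remaining forest at the separators gives exactly the blocks. The deleted nonterminals
occur at most once each and their rules are at most binary, so the forest has at most one root more
than there are deleted nonterminals; the new rules for the sublists are therefore paid for by the
deleted ones (`numRules_slp_le`). -/

theorem hasEarlierCopy_iff {s : List T} {i ℓ : ℕ} :
    HasEarlierCopy s i ℓ ↔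
      i + ℓ ≤ s.length ∧ ∃ j < i, ∀ t < ℓ, s[j + t]? = s[i + t]? := by
  unfold HasEarlierCopy
  refine and_congr_right fun _ => exists_congr fun j => and_congr_right fun _ => ?_
  constructor
  · intro h t ht
    have := congrArg (fun l => l[t]?) h
    simpa [List.getElem?_take, ht] using this
  · intro h
    apply List.ext_getElem?
    intro t
    by_cases ht : t < ℓ
    · simpa [List.getElem?_take, ht] using h t ht
    · simp [ht]

theorem HasEarlierCopy.mono {s : List T} {i ℓ x m : ℕ} (h : HasEarlierCopy s i ℓ)
    (hx : i ≤ x) (hm : x + m ≤ i + ℓ) : HasEarlierCopy s x m := by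
  rw [hasEarlierCopy_iff] at h ⊢
  obtain ⟨h1, j, hj, hc⟩ := h
  refine ⟨by omega, j + (x - i), by omega, fun t ht => ?_⟩
  have := hc (x - i + t) (by omega)
  rwa [show j + (x - i + t) = j + (x - i) + t by omega,
    show i + (x - i + t) = x + t by omega] at this

theorem hasEarlierCopy_longestCopy {s : List T} {i : ℕ} (h : longestCopy s i ≠ 0) :
    HasEarlierCopy s i (longestCopy s i) := by
  classical
  unfold longestCopy at h ⊢
  exact Nat.findGreatest_of_ne_zero rfl h

theorem not_hasEarlierCopy_of_longestCopy_lt {s : List T} {i ℓ : ℕ} (h : longestCopy s i < ℓ) :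
    ¬ HasEarlierCopy s i ℓ := by
  classical
  intro hc
  unfold longestCopy at h
  exact Nat.findGreatest_is_greatest h (by have := hc.1; omega) hc

/-- The last positions of the LZ77 phrases: a substring avoiding them has an earlier copy. -/
theorem exists_finset_lz77From (s : List T) (i : ℕ) :
    ∃ E : Finset ℕ, E.card ≤ (lz77From s i).length ∧
      ∀ x ℓ, i ≤ x → 0 < ℓ → x + ℓ ≤ s.length → (∀ e ∈ E, e < x ∨ x + ℓ ≤ e) →
        HasEarlierCopy s x ℓ := by
  induction i using lz77From.induct s with
  | case1 i hi ih =>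
    obtain ⟨E, hE, hc⟩ := ih
    -- If the phrase lacks its further character, this mark equals `s.length` and lies in no
    -- substring.
    refine ⟨insert (i + longestCopy s i) E, ?_, ?_⟩
    · rw [lz77From, if_pos hi]
      exact (Finset.card_insert_le _ _).trans (by simpa using hE)
    · intro x ℓ hx hℓ hn hav
      by_cases h : i + (longestCopy s i + 1) ≤ x
      · exact hc x ℓ h hℓ hn fun e he => hav e (Finset.mem_insert_of_mem he)
      · have := hav _ (Finset.mem_insert_self _ _)
        exact (hasEarlierCopy_longestCopy (by omega)).mono hx (by omega)
  | case2 i hi =>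
    exact ⟨∅, by simp, fun x ℓ hx hℓ hn => by omega⟩

theorem exists_finset_numPhrases (s : List T) :
    ∃ E : Finset ℕ, E.card ≤ numPhrases s ∧
      ∀ x ℓ, 0 < ℓ → x + ℓ ≤ s.length → (∀ e ∈ E, e < x ∨ x + ℓ ≤ e) →
        HasEarlierCopy s x ℓ := by
  obtain ⟨E, hE, h⟩ := exists_finset_lz77From s 0
  exact ⟨E, hE, fun x ℓ => h x ℓ (Nat.zero_le _)⟩

/-- Two consecutive phrases contain a mark: otherwise their concatenation splits into two copied
pieces, the first no longer than the copied part of the first phrase, so the second piece covers the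
whole second phrase, against its maximality. The summand 2 pays for a last pair that reaches the
end. -/
theorem length_lz77From_le {s : List T} {M : Finset ℕ}
    (h : ∀ x ℓ, 0 < ℓ → x + ℓ ≤ s.length → (∀ e ∈ M, e < x ∨ x + ℓ ≤ e) →
      ∃ m ≤ ℓ, HasEarlierCopy s x m ∧ HasEarlierCopy s (x + m) (ℓ - m)) (i : ℕ) :
    (lz77From s i).length ≤ 2 * (M.filter (i ≤ ·)).card + 2 := by
  induction hn : s.length - i using Nat.strong_induction_on generalizing i with
  | _ n ih =>
    rw [lz77From]
    split_ifs with hi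
    swap
    · simp
    rw [lz77From]
    split_ifs with hi'
    swap
    · simp
    set i' := i + (longestCopy s i + 1) with hi'_def
    set i'' := i' + (longestCopy s i' + 1) with hi''_def
    by_cases hi'' : i'' < s.length
    swap
    · rw [lz77From, if_neg hi'']
      simp
    -- If no mark lies in `[i, i'')`, the two filtered sets coincide.
    have hlt : (M.filter (i'' ≤ ·)).card < (M.filter (i ≤ ·)).card := by
      by_contra hcon
      have hsub : M.filter (i'' ≤ ·) ⊆ M.filter (i ≤ ·) := fun e he => by
        rw [Finset.mem_filter] at he ⊢
        exact ⟨he.1, by omega⟩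
      have heq := Finset.eq_of_subset_of_card_le hsub (not_lt.mp hcon)
      obtain ⟨m, hm, h1, h2⟩ := h i (i'' - i) (by omega) (by omega) fun e he => by
        by_contra hne
        have : e ∈ M.filter (i'' ≤ ·) := by
          rw [heq, Finset.mem_filter]
          exact ⟨he, by omega⟩
        rw [Finset.mem_filter] at this
        omega
      have hm' : m ≤ longestCopy s i := by
        by_contra hc
        exact not_hasEarlierCopy_of_longestCopy_lt (not_le.mp hc) h1
      exact not_hasEarlierCopy_of_longestCopy_lt (Nat.lt_succ_self _)
        (h2.mono (x := i') (m := longestCopy s i' + 1) (by omega) (by omega))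
    have := ih (s.length - i'') (by omega) i'' rfl
    simp only [List.length_cons]
    omega

/-- If every nonempty substring avoiding the positions in `M` is the concatenation of two strings
with earlier copies, then there are at most `2 * M.card + 2` phrases. -/
theorem numPhrases_le {s : List T} {M : Finset ℕ}
    (h : ∀ x ℓ, 0 < ℓ → x + ℓ ≤ s.length → (∀ e ∈ M, e < x ∨ x + ℓ ≤ e) →
      ∃ m ≤ ℓ, HasEarlierCopy s x m ∧ HasEarlierCopy s (x + m) (ℓ - m)) :
    numPhrases s ≤ 2 * M.card + 2 := by
  simpa [numPhrases, lz77] using length_lz77From_le h 0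

theorem HasEarlierCopy.split {s : List T} {x ℓ : ℕ} (h : HasEarlierCopy s x ℓ) :
    ∃ m ≤ ℓ, HasEarlierCopy s x m ∧ HasEarlierCopy s (x + m) (ℓ - m) :=
  ⟨ℓ, le_rfl, h, h.mono (by omega) (by omega)⟩

theorem numPhrases_pos {s : List T} (hs : s ≠ []) : 0 < numPhrases s := by
  have := List.length_pos_of_ne_nil hs
  unfold numPhrases lz77
  rw [lz77From, if_pos this]
  simp

end LZ77

/-! ### Block boundaries as positions of the concatenation -/

section Boundaries

variable {T : Type u}

/-- The position in `P.flatten` at which the `k`-th block starts. -/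
def bd (P : List (List T)) (k : ℕ) : ℕ := (P.take k).flatten.length

theorem bd_zero (P : List (List T)) : bd P 0 = 0 := by simp [bd]

theorem bd_length (P : List (List T)) : bd P P.length = P.flatten.length := by simp [bd]

theorem bd_succ {P : List (List T)} {k : ℕ} {B : List T} (h : P[k]? = some B) :
    bd P (k + 1) = bd P k + B.length := by
  simp [bd, List.take_add_one, h]

theorem bd_mono (P : List (List T)) : Monotone (bd P) := by
  refine monotone_nat_of_le_succ fun k => ?_
  simp [bd, List.take_add_one]

theorem getElem?_flatten_bd {P : List (List T)} {k : ℕ} {B : List T} (h : P[k]? = some B)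
    {o : ℕ} (ho : o < B.length) : P.flatten[bd P k + o]? = B[o]? := by
  have hk : k < P.length := (List.getElem?_eq_some_iff.mp h).1
  have hB : P.drop k = B :: P.drop (k + 1) := by
    rw [List.drop_eq_getElem_cons hk, (List.getElem?_eq_some_iff.mp h).2]
  have hf : P.flatten = (P.take k ++ B :: P.drop (k + 1)).flatten := by
    rw [← hB, List.take_append_drop]
  rw [hf, List.flatten_append, List.flatten_cons, bd, List.getElem?_append_right (by omega),
    Nat.add_sub_cancel_left, List.getElem?_append_left ho]

theorem exists_bd_le_lt {P : List (List T)} {x : ℕ} (hx : x < P.flatten.length) :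
    ∃ k B, P[k]? = some B ∧ bd P k ≤ x ∧ x < bd P k + B.length := by
  have hex : ∃ k, x < bd P k := ⟨P.length, by rwa [bd_length]⟩
  classical
  have h0 : Nat.find hex ≠ 0 := fun h => by
    have := Nat.find_spec hex
    rw [h, bd_zero] at this
    omega
  obtain ⟨k, hk⟩ := Nat.exists_eq_succ_of_ne_zero h0
  have h1 := Nat.find_spec hex
  have h2 := Nat.find_min hex (m := k) (by omega)
  rw [hk, Nat.succ_eq_add_one] at h1
  cases hB : P[k]? with
  | none => simp [bd, List.take_add_one, hB] at h1 h2; omega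
  | some B => exact ⟨k, B, hB, by omega, by rwa [bd_succ hB] at h1⟩

theorem bd_lt_iff {P : List (List T)} (hP : ∀ B ∈ P, B ≠ []) {i j : ℕ} (hi : i ≤ P.length)
    (hj : j ≤ P.length) : bd P i < bd P j ↔ i < j := by
  constructor
  · intro h
    by_contra hc
    exact absurd (bd_mono P (not_lt.mp hc)) (by omega)
  · intro h
    have hB : P[i]? = some P[i] := by simp
    have h1 := bd_succ hB
    have h2 := bd_mono P (show i + 1 ≤ j from h)
    have := List.length_pos_of_ne_nil (hP _ (List.getElem_mem (by omega : i < P.length)))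
    omega

end Boundaries

/-! ### Reset points and the LZ77 parse of `P` -/

section Parse

variable {σ : Type u} (R : Rsync σ)

theorem Rsync.triggering_of_blockLength_lt {x : List σ} (h : R.blockLength x < x.length) :
    R.w ≤ R.blockLength x ∧
      R.Triggering ((x.drop (R.blockLength x - R.w)).take R.w) := by
  classical
  unfold Rsync.blockLength at h ⊢
  split at h
  · rename_i k hk
    have := List.find?_some hk
    simpa using this
  · omega

theorem Rsync.flatten_parse (x : List σ) : (R.parse x).flatten = x := by
  induction x using Rsync.parse.induct R with
  | case1 => rw [Rsync.parse]; simp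
  | case2 x hx ih => rw [Rsync.parse, dif_neg hx, List.flatten_cons, ih, List.take_append_drop]

theorem Rsync.ne_nil_of_mem_parse {x B : List σ} (hB : B ∈ R.parse x) : B ≠ [] := by
  induction x using Rsync.parse.induct R with
  | case1 => rw [Rsync.parse] at hB; simp at hB
  | case2 x hx ih =>
    rw [Rsync.parse, dif_neg hx, List.mem_cons] at hB
    rcases hB with rfl | hB
    · have := R.blockLength_pos hx
      simp only [ne_eq, List.take_eq_nil_iff, not_or]
      exact ⟨by omega, hx⟩
    · exact ih hB

/-- A block followed by another one stops short of the end of the text, so a trigger ended it. The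
last block is excluded: it may be a mere remainder. -/
theorem Rsync.triggering_of_mem_parse {x : List σ} {k : ℕ} {B : List σ}
    (hB : (R.parse x)[k]? = some B) (hk : k + 1 < (R.parse x).length) :
    R.w ≤ B.length ∧ R.Triggering (B.drop (B.length - R.w)) := by
  induction x using Rsync.parse.induct R generalizing k with
  | case1 => rw [Rsync.parse] at hB; simp at hB
  | case2 x hx ih =>
    rw [Rsync.parse, dif_neg hx] at hB hk
    cases k with
    | zero =>
      have hne : x.drop (R.blockLength x) ≠ [] := fun h => by
        rw [h, Rsync.parse] at hk
        simp at hk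
      have hlt : R.blockLength x < x.length := by simpa using hne
      have := R.triggering_of_blockLength_lt hlt
      simp only [List.getElem?_cons_zero, Option.some.injEq] at hB
      subst hB
      rw [List.length_take, min_eq_left hlt.le, List.drop_take]
      rwa [Nat.sub_sub_self this.1]
    | succ k =>
      exact ih (by simpa using hB) (by simpa using hk)

variable {R}

theorem Rsync.isReset_bd {S : List σ} {k : ℕ} (hk : 0 < k) (hk' : k < (R.parse S).length) :
    R.IsReset S (bd (R.parse S) k) := by
  obtain ⟨k, rfl⟩ := Nat.exists_eq_succ_of_ne_zero hk.ne'
  have hB : (R.parse S)[k]? = some (R.parse S)[k] := by simp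
  obtain ⟨h1, h2⟩ := R.triggering_of_mem_parse hB hk'
  refine ⟨(R.parse S).take k, _, (R.parse S).drop (k + 1), ?_, h1, h2, bd_succ hB⟩
  rw [List.getElem_cons_drop, List.take_append_drop]

theorem Rsync.IsReset.exists_bd {S : List σ} {e : ℕ} (h : R.IsReset S e) :
    ∃ k, 0 < k ∧ k ≤ (R.parse S).length ∧ e = bd (R.parse S) k := by
  obtain ⟨pre, B, post, h1, -, -, h2⟩ := h
  refine ⟨pre.length + 1, by omega, by simp [h1], ?_⟩
  rw [h1, bd_succ (B := B) (by simp)]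
  simp [bd, h2]

theorem Rsync.le_bd_succ_sub {S : List σ} {k : ℕ} (hk : k + 1 < (R.parse S).length) :
    bd (R.parse S) k + R.w ≤ bd (R.parse S) (k + 1) := by
  have hB : (R.parse S)[k]? = some (R.parse S)[k] := by simp
  rw [bd_succ hB]
  have := (R.triggering_of_mem_parse hB hk).1
  omega

theorem Rsync.bd_parse_lt_iff {S : List σ} {i j : ℕ} (hi : i ≤ (R.parse S).length)
    (hj : j ≤ (R.parse S).length) : bd (R.parse S) i < bd (R.parse S) j ↔ i < j :=
  bd_lt_iff (fun _ => R.ne_nil_of_mem_parse) hi hj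

theorem Rsync.bd_parse_length (S : List σ) : bd (R.parse S) (R.parse S).length = S.length := by
  rw [bd_length, R.flatten_parse]

theorem Rsync.ContextTriggered.isReset {S : List σ} (h : R.ContextTriggered S) {i j : ℕ}
    (hi : i + R.w ≤ S.length) (hj : j + R.w ≤ S.length)
    (hc : ∀ t < R.w, S[i + t]? = S[j + t]?) (hr : R.IsReset S (i + R.w)) :
    R.IsReset S (j + R.w) := by
  refine h i j hi hj ?_ hr
  apply List.ext_getElem?
  intro t
  by_cases ht : t < R.w
  · simpa [ht] using hc t ht
  · simp [ht]

/-- An earlier copy of the text of some consecutive blocks, together with the window in front of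
them, consists of the same blocks. -/
theorem Rsync.ContextTriggered.hasEarlierCopy_parse {S : List σ} (h : R.ContextTriggered S)
    {a b : ℕ} (ha : 0 < a) (hab : a ≤ b) (hb : b < (R.parse S).length)
    (hc : HasEarlierCopy S (bd (R.parse S) a - R.w)
      (bd (R.parse S) b - (bd (R.parse S) a - R.w))) :
    HasEarlierCopy (R.parse S) a (b - a) := by
  have haw : R.w ≤ bd (R.parse S) a := by
    have := R.le_bd_succ_sub (S := S) (k := a - 1) (by omega)
    rw [Nat.sub_add_cancel ha] at this
    omega
  have hmono := bd_mono (R.parse S)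
  have hN := R.bd_parse_length S
  have hbn := (R.bd_parse_lt_iff hb.le le_rfl).mpr hb
  rw [hasEarlierCopy_iff] at hc
  obtain ⟨-, j, hj, hc⟩ := hc
  obtain ⟨δ, hδ⟩ : ∃ δ, δ = bd (R.parse S) a - R.w - j := ⟨_, rfl⟩
  have hcopy : ∀ x, bd (R.parse S) a - R.w ≤ x → x < bd (R.parse S) b → S[x - δ]? = S[x]? := fun x hx hx' => by
    have := hc (x - (bd (R.parse S) a - R.w)) (by omega)
    rwa [show j + (x - (bd (R.parse S) a - R.w)) = x - δ by omega,
      show bd (R.parse S) a - R.w + (x - (bd (R.parse S) a - R.w)) = x by omega] at this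
  -- The window ending at `e` lies in the copied text, because that text begins `w` characters
  -- before block `a`.
  have hreset : ∀ e, bd (R.parse S) a ≤ e → e ≤ bd (R.parse S) b → (R.IsReset S (e - δ) ↔ R.IsReset S e) := by
    intro e he he'
    have e1 : e - δ = (e - δ - R.w) + R.w := by omega
    have e2 : e = (e - R.w) + R.w := by omega
    have heq : ∀ t < R.w, S[e - δ - R.w + t]? = S[e - R.w + t]? := fun t ht => by
      have := hcopy (e - R.w + t) (by omega) (by omega)
      rwa [show e - R.w + t - δ = e - δ - R.w + t by omega] at this
    constructor
    · intro hr
      rw [e1] at hr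
      rw [e2]
      exact h.isReset (by omega) (by omega) heq hr
    · intro hr
      rw [e2] at hr
      rw [e1]
      exact h.isReset (by omega) (by omega) (fun t ht => (heq t ht).symm) hr
  have hra := R.isReset_bd (S := S) ha (by omega)
  rw [← hreset _ le_rfl (hmono hab)] at hra
  obtain ⟨a', ha'0, ha', hea⟩ := hra.exists_bd
  -- Boundaries correspond one by one: an additional boundary in the copy would be a reset point,
  -- and shifting it back would put a boundary inside a block of the original.
  have hblocks : ∀ t, a + t ≤ b → a' + t ≤ (R.parse S).length ∧ bd (R.parse S) (a + t) - δ = bd (R.parse S) (a' + t) := by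
    intro t
    induction t with
    | zero => exact fun _ => ⟨ha', hea⟩
    | succ t ih =>
      intro ht
      obtain ⟨h1, h2⟩ := ih (by omega)
      have hm1 := hmono (show a ≤ a + t by omega)
      have hm2 := hmono ht
      have hlt : bd (R.parse S) (a + t) < bd (R.parse S) (a + (t + 1)) :=
        (R.bd_parse_lt_iff (by omega) (by omega)).mpr (by omega)
      have hr := R.isReset_bd (S := S) (k := a + (t + 1)) (by omega) (by omega)
      rw [← hreset _ (by omega) hm2] at hr
      obtain ⟨c, -, hcN, hce⟩ := hr.exists_bd
      have hcgt : a' + t < c := (R.bd_parse_lt_iff h1 hcN).mp (by omega)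
      refine ⟨by omega, ?_⟩
      rw [hce]
      congr 1
      by_contra hne
      have hlt2 : a' + (t + 1) < c := by omega
      have h3 := (R.bd_parse_lt_iff (S := S) (by omega) hcN).mpr hlt2
      have h4 := (R.bd_parse_lt_iff (S := S) (i := a' + t) (j := a' + (t + 1))
        (by omega) (by omega)).mpr (by omega)
      have hr' := R.isReset_bd (S := S) (k := a' + (t + 1)) (by omega) (by omega)
      rw [show bd (R.parse S) (a' + (t + 1)) = bd (R.parse S) (a' + (t + 1)) + δ - δ by omega,
        hreset _ (by omega) (by omega)] at hr'
      obtain ⟨d, -, hdN, hde⟩ := hr'.exists_bd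
      have h5 := (R.bd_parse_lt_iff (S := S) (i := a + t) (j := d) (by omega) hdN).mp
        (by omega)
      have h6 := (R.bd_parse_lt_iff (S := S) (i := d) (j := a + (t + 1)) hdN (by omega)).mp
        (by omega)
      omega
  have ha'a : a' < a := (R.bd_parse_lt_iff (S := S) ha' (by omega)).mp (by omega)
  rw [hasEarlierCopy_iff]
  refine ⟨by omega, a', ha'a, fun t ht => ?_⟩
  have h1 := hblocks t (by omega)
  have h2 := hblocks (t + 1) (by omega)
  have e1 : (R.parse S)[a' + t]? = some (R.parse S)[a' + t] := List.getElem?_eq_getElem (by omega)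
  have e2 : (R.parse S)[a + t]? = some (R.parse S)[a + t] := List.getElem?_eq_getElem (by omega)
  have l1 := bd_succ e1
  have l2 := bd_succ e2
  have hm1 := hmono (show a ≤ a + t by omega)
  have hm2 := hmono (show a + (t + 1) ≤ b by omega)
  rw [← add_assoc, ← add_assoc] at h2
  rw [← add_assoc] at hm2
  rw [e1, e2, Option.some.injEq]
  apply List.ext_getElem?
  intro o
  by_cases ho : o < (R.parse S)[a + t].length
  · rw [← getElem?_flatten_bd e1 (by omega), ← getElem?_flatten_bd e2 ho, R.flatten_parse,
      ← hcopy (bd (R.parse S) (a + t) + o) (by omega) (by omega)]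
    congr 1
    omega
  · rw [List.getElem?_eq_none (by omega), List.getElem?_eq_none (by omega)]

/-- The parse is covered by few positions. -/
theorem Rsync.ContextTriggered.exists_finset_parse {S : List σ} (h : R.ContextTriggered S) :
    ∃ M : Finset ℕ, M.card ≤ 2 * numPhrases S + 2 ∧
      ∀ x ℓ, 0 < ℓ → x + ℓ ≤ (R.parse S).length → (∀ e ∈ M, e < x ∨ x + ℓ ≤ e) →
        HasEarlierCopy (R.parse S) x ℓ := by
  classical
  obtain ⟨E, hE, hcov⟩ := exists_finset_numPhrases S
  -- `f e` is the block containing `e`; its value for `e` outside `S` is junk.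
  have hex : ∀ e, ∃ k, e < S.length → k < (R.parse S).length ∧
      bd (R.parse S) k ≤ e ∧ e < bd (R.parse S) (k + 1) := fun e => by
    by_cases he : e < S.length
    · obtain ⟨k, B, h1, h2, h3⟩ := exists_bd_le_lt (P := R.parse S) (x := e)
        (by rwa [R.flatten_parse])
      exact ⟨k, fun _ => ⟨(List.getElem?_eq_some_iff.mp h1).1, h2, by rwa [bd_succ h1]⟩⟩
    · exact ⟨0, fun h => absurd h he⟩
  choose f hf using hex
  -- Mark 0 guarantees a preceding block, and the last index keeps the right end of the range a
  -- reset point. The mark `f e + 1` is needed because the window in front of block `x` lies in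
  -- block `x - 1`, so a phrase end there must exclude `x` too.
  refine ⟨({0, (R.parse S).length - 1} ∪ E.image f) ∪ E.image (fun e => f e + 1), ?_, ?_⟩
  · have h1 := Finset.card_union_le ({0, (R.parse S).length - 1} ∪ E.image f)
      (E.image (fun e => f e + 1))
    have h2 := Finset.card_union_le {0, (R.parse S).length - 1} (E.image f)
    have h3 := Finset.card_le_two (a := 0) (b := (R.parse S).length - 1)
    have h4 := Finset.card_image_le (s := E) (f := f)
    have h5 := Finset.card_image_le (s := E) (f := fun e => f e + 1)
    omega
  · intro x ℓ hℓ hx hM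
    have m0 := hM 0 (by simp)
    have m1 := hM ((R.parse S).length - 1) (by simp)
    have hw : ∀ k, 0 < k → k < (R.parse S).length → bd (R.parse S) (k - 1) + R.w ≤ bd (R.parse S) k := fun k h0 h1 => by
      have := R.le_bd_succ_sub (S := S) (k := k - 1) (by omega)
      rwa [Nat.sub_add_cancel h0] at this
    have hwx := hw x (by omega) (by omega)
    have hmono := bd_mono (R.parse S)
    have hN := R.bd_parse_length S
    have hlt := (R.bd_parse_lt_iff (S := S) (i := x) (j := x + ℓ) (by omega) (by omega)).mpr
      (by omega)
    have hle := hmono hx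
    have hc := hcov (bd (R.parse S) x - R.w) (bd (R.parse S) (x + ℓ) - (bd (R.parse S) x - R.w)) (by omega) (by omega) <| by
      intro e he
      by_contra hne
      obtain ⟨f1, f2, f3⟩ := hf e (by omega)
      have m2 := hM (f e) (by
        simp only [Finset.mem_union, Finset.mem_image]; exact Or.inl (Or.inr ⟨e, he, rfl⟩))
      have m3 := hM (f e + 1) (by
        simp only [Finset.mem_union, Finset.mem_image]; exact Or.inr ⟨e, he, rfl⟩)
      have g1 : f e < x + ℓ := (R.bd_parse_lt_iff (S := S) f1.le hx).mp (by omega)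
      have g2 : x - 1 < f e + 1 :=
        (R.bd_parse_lt_iff (S := S) (i := x - 1) (j := f e + 1) (by omega) f1).mp
        (by omega)
      omega
    have := h.hasEarlierCopy_parse (a := x) (b := x + ℓ) (by omega) (by omega) (by omega) hc
    rwa [Nat.add_sub_cancel_left] at this

theorem Rsync.ContextTriggered.numPhrases_parse_le {S : List σ} (h : R.ContextTriggered S) :
    numPhrases (R.parse S) ≤ 4 * numPhrases S + 6 := by
  obtain ⟨M, hM, hcov⟩ := h.exists_finset_parse
  have := numPhrases_le (M := M) fun x ℓ h1 h2 h3 => (hcov x ℓ h1 h2 h3).split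
  omega

end Parse

/-! ### The dictionary and the LZ77 parse of `D` -/

section Dictionary

variable {T : Type u}

theorem reverse_dedup_reverse_append_singleton [DecidableEq T] (l : List T) (a : T) :
    (l ++ [a]).reverse.dedup.reverse =
      if a ∈ l then l.reverse.dedup.reverse else l.reverse.dedup.reverse ++ [a] := by
  rw [List.reverse_append, List.reverse_singleton, List.singleton_append]
  split_ifs with h
  · rw [List.dedup_cons_of_mem (by simpa using h)]
  · rw [List.dedup_cons_of_notMem (by simpa using h), List.reverse_cons]

theorem idxOf_le_of_getElem? [BEq T] [LawfulBEq T] {l : List T} {a : T} {k : ℕ}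
    (h : l[k]? = some a) : l.idxOf a ≤ k := by
  obtain ⟨hk, rfl⟩ := List.getElem?_eq_some_iff.mp h
  by_contra hcon
  have := List.not_of_lt_findIdx (not_le.mp hcon)
  simp at this

/-- Appending a character at the right leaves the list of first appearances unchanged or extends it
at its end. This order is what turns earlier blocks of `S` into earlier positions of `D`. -/
theorem idxOf_reverse_dedup_reverse_lt [DecidableEq T] [BEq T] [LawfulBEq T] {l : List T} {a b : T} (hb : b ∈ l)
    (h : l.idxOf a < l.idxOf b) :
    l.reverse.dedup.reverse.idxOf a < l.reverse.dedup.reverse.idxOf b := by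
  induction l using List.reverseRecOn with
  | nil => simp at hb
  | append_singleton l c ih =>
    have ha : a ∈ l := by
      by_contra ha
      rw [List.idxOf_append_of_notMem ha] at h
      have := List.idxOf_lt_length_of_mem hb
      rw [List.length_append, List.length_singleton] at this
      omega
    have ha' : a ∈ l.reverse.dedup.reverse := by simpa using ha
    rw [List.idxOf_append_of_mem ha] at h
    rw [reverse_dedup_reverse_append_singleton]
    by_cases hbl : b ∈ l
    · have hb' : b ∈ l.reverse.dedup.reverse := by simpa using hbl
      rw [List.idxOf_append_of_mem hbl] at h
      split_ifs with hc
      · exact ih hbl h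
      · rw [List.idxOf_append_of_mem ha', List.idxOf_append_of_mem hb']
        exact ih hbl h
    · have hbc : b = c := by simpa [hbl] using hb
      subst hbc
      rw [if_neg hbl, List.idxOf_append_of_mem ha',
        List.idxOf_append_of_notMem (by simpa using hbl)]
      have := List.idxOf_lt_length_of_mem ha'
      omega

variable {σ : Type u} {R : Rsync σ} {S : List σ}

theorem Rsync.mem_dictionary {B : List σ} : B ∈ R.dictionary S ↔ B ∈ R.parse S := by
  simp [Rsync.dictionary]

theorem Rsync.nodup_dictionary : (R.dictionary S).Nodup := by
  classical
  unfold Rsync.dictionary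
  exact List.nodup_reverse.mpr (List.nodup_dedup _)

/-- The dictionary blocks with their separators. -/
def markedBlocks (d : List (List σ)) : List (List (σ ⊕ ℕ)) :=
  d.zipIdx.map fun Bi => Bi.1.map Sum.inl ++ [Sum.inr Bi.2]

theorem length_markedBlocks (d : List (List σ)) : (markedBlocks d).length = d.length := by
  simp [markedBlocks]

theorem Rsync.dictString_eq : R.dictString S = (markedBlocks (R.dictionary S)).flatten := by
  rw [Rsync.dictString, markedBlocks, List.flatMap]

theorem markedBlocks_getElem? {d : List (List σ)} {i : ℕ} {B : List σ} (h : d[i]? = some B) :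
    (markedBlocks d)[i]? = some (B.map Sum.inl ++ [Sum.inr i]) := by
  simp [markedBlocks, h]

theorem bd_markedBlocks_succ {d : List (List σ)} {i : ℕ} {B : List σ} (h : d[i]? = some B) :
    bd (markedBlocks d) (i + 1) = bd (markedBlocks d) i + B.length + 1 := by
  rw [bd_succ (markedBlocks_getElem? h)]
  simp [add_assoc]

theorem getElem?_flatten_markedBlocks {d : List (List σ)} {i o : ℕ} {B : List σ}
    (h : d[i]? = some B) (ho : o < B.length) :
    (markedBlocks d).flatten[bd (markedBlocks d) i + o]? = B[o]?.map Sum.inl := by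
  rw [getElem?_flatten_bd (markedBlocks_getElem? h) (by simp; omega),
    List.getElem?_append_left (by simpa using ho), List.getElem?_map]

/-- A substring of `S` that lies within one block, occurring in the dictionary before the given
position, gives an earlier copy. -/
theorem Rsync.hasEarlierCopy_dictString {k k' : ℕ} {B B' : List σ}
    {i o o' ℓ : ℕ} (hi : (R.dictionary S)[i]? = some B)
    (hk : (R.parse S)[k]? = some B) (hfirst : ∀ k', (R.parse S)[k']? = some B → k ≤ k')
    (hk' : (R.parse S)[k']? = some B') (ho : o + ℓ ≤ B.length) (ho' : o' + ℓ ≤ B'.length)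
    (hlt : k' < k ∨ k' = k ∧ o' < o) (hc : ∀ t < ℓ, B'[o' + t]? = B[o + t]?) :
    HasEarlierCopy (R.dictString S) (bd (markedBlocks (R.dictionary S)) i + o) ℓ := by
  classical
  obtain ⟨hi', hiB⟩ := List.getElem?_eq_some_iff.mp hi
  have hB'mem : B' ∈ R.dictionary S := R.mem_dictionary.mpr (List.mem_of_getElem? hk')
  have hidx : (R.dictionary S).idxOf B' < (R.dictionary S).length :=
    List.idxOf_lt_length_of_mem hB'mem
  obtain ⟨i', hi'_def⟩ : ∃ i', i' = (R.dictionary S).idxOf B' := ⟨_, rfl⟩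
  have hdi' : (R.dictionary S)[i']? = some B' := by
    rw [hi'_def, List.getElem?_eq_getElem hidx, List.getElem_idxOf]
  have hidxB : (R.dictionary S).idxOf B = i := by
    rw [← hiB, R.nodup_dictionary.idxOf_getElem]
  have hkB : (R.parse S).idxOf B = k := by
    have hmem := List.mem_of_getElem? hk
    refine le_antisymm ?_ (hfirst _ ?_)
    · exact idxOf_le_of_getElem? hk
    · rw [List.getElem?_eq_getElem (List.idxOf_lt_length_of_mem hmem), List.getElem_idxOf]
  have key : i' < i ∨ i' = i ∧ o' < o := by
    rcases hlt with hlt | ⟨rfl, hlt⟩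
    · left
      rw [hi'_def, ← hidxB]
      refine idxOf_reverse_dedup_reverse_lt (List.mem_of_getElem? hk) ?_
      rw [hkB]
      exact (idxOf_le_of_getElem? hk').trans_lt hlt
    · right
      rw [hk, Option.some.injEq] at hk'
      exact ⟨by rw [hi'_def, ← hk', hidxB], hlt⟩
  have h1 := bd_markedBlocks_succ hi
  have h2 := bd_markedBlocks_succ hdi'
  have h3 : bd (markedBlocks (R.dictionary S)) (i + 1) ≤ (R.dictString S).length := by
    rw [R.dictString_eq, ← bd_length]
    exact bd_mono _ (by rw [length_markedBlocks]; omega)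
  rw [hasEarlierCopy_iff]
  refine ⟨by omega, bd (markedBlocks (R.dictionary S)) i' + o', ?_, fun t ht => ?_⟩
  · rcases key with h | ⟨h, h'⟩
    · have := bd_mono (markedBlocks (R.dictionary S)) (show i' + 1 ≤ i from h)
      omega
    · subst h
      omega
  · rw [R.dictString_eq, add_assoc, add_assoc, getElem?_flatten_markedBlocks hdi' (by omega),
      getElem?_flatten_markedBlocks hi (by omega), hc t ht]

theorem Rsync.getElem?_parse_bd {k o : ℕ} {B : List σ} (h : (R.parse S)[k]? = some B)
    (ho : o < B.length) : S[bd (R.parse S) k + o]? = B[o]? := by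
  rw [← getElem?_flatten_bd h ho, R.flatten_parse]

/-- The first occurrence of a block, as a substring of `P` of length 1, has no earlier copy and
hence is one of the marks. -/
theorem Rsync.ContextTriggered.length_dictionary_le (h : R.ContextTriggered S) :
    (R.dictionary S).length ≤ 2 * numPhrases S + 2 := by
  classical
  obtain ⟨M, hM, hcov⟩ := h.exists_finset_parse
  refine le_trans ?_ hM
  rw [← List.toFinset_card_of_nodup R.nodup_dictionary]
  refine Finset.card_le_card_of_injOn (fun B => (R.parse S).idxOf B) ?_ ?_
  · intro B hB
    have hB : B ∈ R.parse S := by simpa [R.mem_dictionary] using hB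
    have hlt := List.idxOf_lt_length_of_mem hB
    by_contra hnot
    have := hcov ((R.parse S).idxOf B) 1 one_pos hlt fun e he => by
      have : e ≠ (R.parse S).idxOf B := fun h => hnot (by simpa [← h] using he)
      omega
    rw [hasEarlierCopy_iff] at this
    obtain ⟨-, j, hj, hc⟩ := this
    have hc := hc 0 one_pos
    rw [add_zero, add_zero, List.getElem?_eq_getElem hlt, List.getElem_idxOf] at hc
    exact absurd (idxOf_le_of_getElem? hc) (by omega)
  · intro B hB B' hB' heq
    have hB : B ∈ R.parse S := by simpa [R.mem_dictionary] using hB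
    exact (List.idxOf_inj hB).mp heq

/-- If a substring of the first occurrence of a block has an earlier copy in `S`, then it is the
concatenation of two strings with earlier copies in the dictionary string. -/
theorem Rsync.ContextTriggered.split_dictString (h : R.ContextTriggered S) {k i o ℓ : ℕ}
    {B : List σ} (hi : (R.dictionary S)[i]? = some B) (hk : (R.parse S)[k]? = some B)
    (hfirst : ∀ k', (R.parse S)[k']? = some B → k ≤ k') (hℓ : 0 < ℓ) (ho : o + ℓ ≤ B.length)
    (hc : HasEarlierCopy S (bd (R.parse S) k + o) ℓ) :
    ∃ m ≤ ℓ,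
      HasEarlierCopy (R.dictString S) (bd (markedBlocks (R.dictionary S)) i + o) m ∧
      HasEarlierCopy (R.dictString S) (bd (markedBlocks (R.dictionary S)) i + o + m) (ℓ - m) := by
  rw [hasEarlierCopy_iff] at hc
  obtain ⟨hn, j, hj, hc⟩ := hc
  have hkl := (List.getElem?_eq_some_iff.mp hk).1
  have hksucc := bd_succ hk
  have hmono := bd_mono (R.parse S)
  obtain ⟨k₁, B₁, hk₁, hj₁, hj₁'⟩ := exists_bd_le_lt (P := R.parse S) (x := j)
    (by rw [R.flatten_parse]; omega)
  have hk₁l := (List.getElem?_eq_some_iff.mp hk₁).1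
  have hk₁succ := bd_succ hk₁
  have hk₁k : k₁ < k + 1 := (R.bd_parse_lt_iff (S := S) (i := k₁) (j := k + 1) (by omega)
    (by omega)).mp (by omega)
  have hlt₁ : k₁ < k ∨ k₁ = k ∧ j - bd (R.parse S) k₁ < o := by
    rcases lt_or_eq_of_le (Nat.lt_succ_iff.mp hk₁k) with h | h
    · exact Or.inl h
    · subst h
      exact Or.inr ⟨rfl, by omega⟩
  -- A prefix of the copy that stays inside block `k₁` is an earlier copy in `D`, even if `k₁ = k`,
  -- since then its offset is smaller.
  have piece₁ : ∀ m ≤ ℓ, j + m ≤ bd (R.parse S) (k₁ + 1) →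
      HasEarlierCopy (R.dictString S) (bd (markedBlocks (R.dictionary S)) i + o) m := by
    intro m hm hjm
    refine R.hasEarlierCopy_dictString hi hk hfirst hk₁ (o' := j - bd (R.parse S) k₁) (by omega)
      (by omega) hlt₁ fun t ht => ?_
    rw [← R.getElem?_parse_bd hk₁ (by omega), ← R.getElem?_parse_bd hk (by omega), ← add_assoc,
      ← add_assoc, Nat.add_sub_cancel' hj₁]
    exact hc t (by omega)
  by_cases hone : j + ℓ ≤ bd (R.parse S) (k₁ + 1)
  · exact (piece₁ ℓ le_rfl hone).split
  push Not at hone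
  have hN := R.bd_parse_length S
  have hkle := hmono (show k + 1 ≤ (R.parse S).length from hkl)
  -- The window before such a reset point lies within the copy, so the reset would reappear strictly
  -- inside block `k`; strictness on the left uses `1 ≤ w`.
  have noreset : ∀ t, R.w ≤ t → t < ℓ → ¬ R.IsReset S (j + t) := by
    intro t ht htℓ hr
    rw [show j + t = (j + (t - R.w)) + R.w by omega] at hr
    have hr' := h.isReset (j := bd (R.parse S) k + o + (t - R.w)) (by omega) (by omega)
      (fun u hu => by
        have := hc (t - R.w + u) (by omega)
        rwa [← add_assoc, ← add_assoc] at this) hr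
    obtain ⟨c, -, hcN, hce⟩ := hr'.exists_bd
    have hw := R.w_pos
    have h1 := (R.bd_parse_lt_iff (S := S) (i := k) (j := c) (by omega) hcN).mp (by omega)
    have h2 := (R.bd_parse_lt_iff (S := S) (i := c) (j := k + 1) hcN (by omega)).mp (by omega)
    omega
  have hk₁N : k₁ + 1 < (R.parse S).length :=
    (R.bd_parse_lt_iff (S := S) (i := k₁ + 1) (by omega) le_rfl).mp (by omega)
  have hr₁ := R.isReset_bd (S := S) (Nat.succ_pos k₁) hk₁N
  have hm_lt : bd (R.parse S) (k₁ + 1) < j + R.w := by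
    by_contra hcon
    refine noreset (bd (R.parse S) (k₁ + 1) - j) (by omega) (by omega) ?_
    rwa [Nat.add_sub_cancel' (by omega)]
  obtain ⟨B₂, hk₂⟩ : ∃ B₂, (R.parse S)[k₁ + 1]? = some B₂ :=
    ⟨_, List.getElem?_eq_getElem hk₁N⟩
  have hk₂succ := bd_succ hk₂
  -- A second boundary inside the copy would be at least `w` beyond the first, hence excluded by
  -- `noreset`.
  have hend : j + ℓ ≤ bd (R.parse S) (k₁ + 1 + 1) := by
    by_contra hcon
    have hk₂N : k₁ + 1 + 1 < (R.parse S).length :=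
      (R.bd_parse_lt_iff (S := S) (i := k₁ + 1 + 1) (by omega) le_rfl).mp (by omega)
    have hr₂ := R.isReset_bd (S := S) (Nat.succ_pos (k₁ + 1)) hk₂N
    have := R.le_bd_succ_sub (S := S) hk₂N
    refine noreset (bd (R.parse S) (k₁ + 1 + 1) - j) (by omega) (by omega) ?_
    rwa [Nat.add_sub_cancel' (by omega)]
  have hk₂k : k₁ + 1 < k + 1 := (R.bd_parse_lt_iff (S := S) (i := k₁ + 1) (j := k + 1) (by omega)
    (by omega)).mp (by omega)
  obtain ⟨m, hm⟩ : ∃ m, j + m = bd (R.parse S) (k₁ + 1) :=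
    ⟨bd (R.parse S) (k₁ + 1) - j, by omega⟩
  refine ⟨m, by omega, piece₁ m (by omega) hm.le, ?_⟩
  rw [add_assoc]
  refine R.hasEarlierCopy_dictString hi hk hfirst hk₂ (o' := 0) (by omega)
    (by omega) ?_ fun t ht => ?_
  · rcases lt_or_eq_of_le (Nat.lt_succ_iff.mp hk₂k) with h | h
    · exact Or.inl h
    · have : bd (R.parse S) k = bd (R.parse S) (k₁ + 1) := by rw [h]
      exact Or.inr ⟨h, by omega⟩
  · rw [← R.getElem?_parse_bd hk₂ (by omega), ← R.getElem?_parse_bd hk (by omega), zero_add, ← hm]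
    have := hc (m + t) (by omega)
    simpa only [add_assoc] using this

theorem Rsync.ContextTriggered.numPhrases_dictString_le (h : R.ContextTriggered S) :
    numPhrases (R.dictString S) ≤ 6 * numPhrases S + 6 := by
  classical
  obtain ⟨E, hE, hcov⟩ := exists_finset_numPhrases S
  have hlen := h.length_dictionary_le
  set d := R.dictionary S with hd
  have hex : ∀ e, ∃ k B, e < S.length → (R.parse S)[k]? = some B ∧
      bd (R.parse S) k ≤ e ∧ e < bd (R.parse S) k + B.length := fun e => by
    by_cases he : e < S.length
    · obtain ⟨k, B, h⟩ := exists_bd_le_lt (P := R.parse S) (x := e) (by rwa [R.flatten_parse])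
      exact ⟨k, B, fun _ => h⟩
    · exact ⟨0, [], fun h => absurd h he⟩
  choose f g hf using hex
  -- The separators, and the phrase ends of `S` transferred to the dictionary copies of their
  -- blocks. Only phrase ends in first occurrences of blocks matter below; the other marks are
  -- harmless.
  let M : Finset ℕ := (Finset.range d.length).image (fun i => bd (markedBlocks d) (i + 1) - 1) ∪
    E.image fun e => bd (markedBlocks d) (d.idxOf (g e)) + (e - bd (R.parse S) (f e))
  have hMcard : M.card ≤ 3 * numPhrases S + 2 := by
    refine (Finset.card_union_le _ _).trans ?_
    have h1 := Finset.card_image_le (s := Finset.range d.length)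
      (f := fun i => bd (markedBlocks d) (i + 1) - 1)
    have h2 := Finset.card_image_le (s := E) (f := fun e => bd (markedBlocks d)
      (d.idxOf (g e)) + (e - bd (R.parse S) (f e)))
    rw [Finset.card_range] at h1
    omega
  refine (numPhrases_le (M := M) ?_).trans (by omega)
  intro x ℓ hℓ hx hM
  rw [R.dictString_eq, ← hd] at hx
  obtain ⟨i, Q, hQ, hix, hix'⟩ := exists_bd_le_lt (P := markedBlocks d) (x := x) (by omega)
  have hil : i < d.length := by
    rw [← length_markedBlocks]
    exact (List.getElem?_eq_some_iff.mp hQ).1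
  obtain ⟨B, hB⟩ : ∃ B, d[i]? = some B := ⟨_, List.getElem?_eq_getElem hil⟩
  rw [← bd_succ hQ] at hix'
  have hsucc := bd_markedBlocks_succ hB
  have hsep := hM (bd (markedBlocks d) (i + 1) - 1) (by
    simp only [M, Finset.mem_union, Finset.mem_image, Finset.mem_range]
    exact Or.inl ⟨i, hil, rfl⟩)
  obtain ⟨o, rfl⟩ := Nat.exists_eq_add_of_le hix
  have ho : o + ℓ ≤ B.length := by omega
  have hBmem : B ∈ R.parse S := R.mem_dictionary.mp (List.mem_of_getElem? hB)
  have hidx := List.idxOf_lt_length_of_mem hBmem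
  obtain ⟨k, hkdef⟩ : ∃ k, k = (R.parse S).idxOf B := ⟨_, rfl⟩
  have hk : (R.parse S)[k]? = some B := by
    rw [hkdef, List.getElem?_eq_getElem hidx, List.getElem_idxOf]
  have hksucc := bd_succ hk
  have hkS : bd (R.parse S) (k + 1) ≤ S.length := by
    rw [← R.bd_parse_length S]
    exact bd_mono _ (by omega)
  refine h.split_dictString hB hk ?_ hℓ ho (hcov _ ℓ hℓ (by omega) fun e he => ?_)
  · intro k' hk'
    exact hkdef ▸ idxOf_le_of_getElem? hk'
  · by_contra hne
    obtain ⟨h1, h2, h3⟩ := hf e (by omega)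
    have hfl := (List.getElem?_eq_some_iff.mp h1).1
    have hfsucc := bd_succ h1
    have a1 := (R.bd_parse_lt_iff (S := S) (i := k) (j := f e + 1) (by omega) (by omega)).mp
      (by omega)
    have a2 := (R.bd_parse_lt_iff (S := S) (i := f e) (j := k + 1) (by omega) (by omega)).mp
      (by omega)
    have hfk : f e = k := by omega
    rw [hfk, hk, Option.some.injEq] at h1
    have hidxB : d.idxOf (g e) = i := by
      rw [← h1, ← (List.getElem?_eq_some_iff.mp hB).2, R.nodup_dictionary.idxOf_getElem]
    have := hM (bd (markedBlocks d) i + (e - bd (R.parse S) k)) (by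
      simp only [M, Finset.mem_union, Finset.mem_image]
      exact Or.inr ⟨e, he, by rw [hidxB, hfk]⟩)
    omega

end Dictionary

/-! ### Splitting and expanding lists -/

section ListLemmas

variable {α : Type u} {β : Type v}

theorem length_filterMap_of_isSome {f : α → Option β} {l : List α}
    (h : ∀ a ∈ l, (f a).isSome) : (l.filterMap f).length = l.length := by
  induction l with
  | nil => rfl
  | cons a l ih =>
    obtain ⟨b, hb⟩ := Option.isSome_iff_exists.mp (h a List.mem_cons_self)
    rw [List.filterMap_cons_some hb, List.length_cons, List.length_cons,
      ih fun a ha => h a (List.mem_cons_of_mem _ ha)]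

theorem flatMap_filterMap_eq {γ : Type*} {f : α → Option β} {g : β → List γ} {h : α → List γ}
    {l : List α} (H : ∀ a ∈ l, ∃ b, f a = some b ∧ g b = h a) :
    (l.filterMap f).flatMap g = l.flatMap h := by
  induction l with
  | nil => rfl
  | cons a l ih =>
    obtain ⟨b, hb, hg⟩ := H a List.mem_cons_self
    rw [List.filterMap_cons_some hb, List.flatMap_cons, List.flatMap_cons, hg,
      ih fun a ha => H a (List.mem_cons_of_mem _ ha)]

theorem splitOnP_append_of_forall {q : β → Bool} {l : List β} (hl : ∀ c ∈ l, q c = false)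
    (L : List β) : (l ++ L).splitOnP q = (L.splitOnP q).modifyHead (l ++ ·) := by
  induction l with
  | nil => cases h : L.splitOnP q <;> simp [h]
  | cons a l ih =>
    rw [List.cons_append, List.splitOnP_cons_eq_if_modifyHead, hl a List.mem_cons_self,
      ih fun c hc => hl c (List.mem_cons_of_mem _ hc)]
    cases h : L.splitOnP q <;> simp

/-- Cutting commutes with expanding as long as separators come only from symbols that are themselves
separators. It is applied to the frontier and the string `D`. -/
theorem splitOnP_flatMap {p : α → Bool} {q : β → Bool} {e : α → List β} {F : List α}
    (h1 : ∀ a ∈ F, p a = true → ∃ c, q c = true ∧ e a = [c])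
    (h2 : ∀ a ∈ F, p a = false → ∀ c ∈ e a, q c = false) :
    (F.flatMap e).splitOnP q = (F.splitOnP p).map (·.flatMap e) := by
  induction F with
  | nil => simp
  | cons a F ih =>
    have ih := ih (fun a ha => h1 a (List.mem_cons_of_mem _ ha))
      (fun a ha => h2 a (List.mem_cons_of_mem _ ha))
    rw [List.flatMap_cons, List.splitOnP_cons_eq_if_modifyHead]
    cases hp : p a with
    | true =>
      obtain ⟨c, hc, he⟩ := h1 a List.mem_cons_self hp
      rw [he, List.singleton_append, List.splitOnP_cons_eq_if_modifyHead, if_pos hc, ih]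
      rfl
    | false =>
      rw [splitOnP_append_of_forall (h2 a List.mem_cons_self hp), ih]
      cases h : F.splitOnP p <;> simp

theorem mem_of_mem_splitOnP {p : α → Bool} {F l : List α} (hl : l ∈ F.splitOnP p) :
    ∀ a ∈ l, a ∈ F ∧ p a = false := by
  induction F generalizing l with
  | nil => simp at hl; simp [hl]
  | cons c F ih =>
    rw [List.splitOnP_cons_eq_if_modifyHead] at hl
    intro a ha
    cases hp : p c with
    | true =>
      rw [hp, if_pos rfl, List.mem_cons] at hl
      rcases hl with rfl | hl
      · simp at ha
      · exact ⟨List.mem_cons_of_mem _ (ih hl a ha).1, (ih hl a ha).2⟩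
    | false =>
      simp only [hp, Bool.false_eq_true, if_false] at hl
      cases hF : F.splitOnP p with
      | nil => simp [hF] at hl
      | cons l' L =>
        rw [hF] at ih hl
        rw [List.modifyHead_cons, List.mem_cons] at hl
        rcases hl with rfl | hl
        · rcases List.mem_cons.mp ha with rfl | ha
          · exact ⟨List.mem_cons_self, hp⟩
          · have := ih List.mem_cons_self a ha
            exact ⟨List.mem_cons_of_mem _ this.1, this.2⟩
        · have := ih (List.mem_cons_of_mem _ hl) a ha
          exact ⟨List.mem_cons_of_mem _ this.1, this.2⟩

theorem sum_length_splitOnP_le (p : α → Bool) (F : List α) :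
    ((F.splitOnP p).map List.length).sum ≤ F.length := by
  induction F with
  | nil => simp
  | cons c F ih =>
    rw [List.splitOnP_cons_eq_if_modifyHead]
    split_ifs with h
    · simp only [List.map_cons, List.length_nil, List.sum_cons, List.length_cons]
      omega
    · cases hF : F.splitOnP p with
      | nil => simp
      | cons l L =>
        rw [hF] at ih
        simp only [List.map_cons, List.sum_cons, List.modifyHead_cons, List.length_cons] at ih ⊢
        omega

theorem sum_length_getD_le (L : List (List α)) (b : ℕ) :
    ∑ i ∈ Finset.range b, (L.getD i []).length ≤ (L.map List.length).sum := by
  induction L generalizing b with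
  | nil => simp
  | cons l L ih =>
    cases b with
    | zero => simp
    | succ b =>
      rw [Finset.sum_range_succ']
      simp only [List.getD_cons_succ, List.getD_cons_zero, List.map_cons, List.sum_cons]
      have := ih b
      omega

end ListLemmas

/-! ### Parse trees: occurrence counts and frontiers -/

namespace SLP

variable {T : Type u} (G : SLP T)

/-- The value of a symbol in a bottom-up evaluation of the parse tree. -/
noncomputable def evalSym {β : Type v} (leaf : T → List β) (node : G.NT → List β → List β) :
    Sym G.NT T → List β
  | Sym.nonterm Y => G.evalTree leaf node Y
  | Sym.term t => leaf t

theorem evalTree_eq_evalSym {β : Type v} (leaf : T → List β) (node : G.NT → List β → List β)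
    (X : G.NT) :
    G.evalTree leaf node X = node X ((G.rule X).flatMap (G.evalSym leaf node)) := by
  rw [evalTree_eq]
  congr 2

/-- The string generated from a symbol. -/
noncomputable def symExp : Sym G.NT T → List T := G.evalSym (fun t => [t]) (fun _ l => l)

@[simp] theorem symExp_term (t : T) : G.symExp (Sym.term t) = [t] := rfl

theorem symExp_nonterm (X : G.NT) :
    G.symExp (Sym.nonterm X) = (G.rule X).flatMap G.symExp :=
  G.evalTree_eq_evalSym (fun t => [t]) (fun _ l => l) X

theorem symExp_start : G.symExp (Sym.nonterm G.start) = G.expansion := rfl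

/-- The labels of the inner nodes of the parse tree rooted at a symbol. -/
noncomputable def symNodes : Sym G.NT T → List G.NT :=
  G.evalSym (fun _ => []) (fun X l => X :: l)

@[simp] theorem symNodes_term (t : T) : G.symNodes (Sym.term t) = [] := rfl

theorem symNodes_nonterm (X : G.NT) :
    G.symNodes (Sym.nonterm X) = X :: (G.rule X).flatMap G.symNodes :=
  G.evalTree_eq_evalSym _ _ X

open Classical in
/-- The roots of the maximal subtrees kept below a symbol. -/
noncomputable def symFrontier (keep : G.NT → Prop) : Sym G.NT T → List (Sym G.NT T) :=
  G.evalSym (fun t => [Sym.term t]) (fun X l => if keep X then [Sym.nonterm X] else l)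

@[simp] theorem symFrontier_term (keep : G.NT → Prop) (t : T) :
    G.symFrontier keep (Sym.term t) = [Sym.term t] := rfl

open Classical in
theorem symFrontier_nonterm (keep : G.NT → Prop) (X : G.NT) :
    G.symFrontier keep (Sym.nonterm X) =
      if keep X then [Sym.nonterm X] else (G.rule X).flatMap (G.symFrontier keep) :=
  G.evalTree_eq_evalSym _ _ X

variable {G}

/-- Induction along the parse tree. -/
theorem sym_induction {p : Sym G.NT T → Prop} (hterm : ∀ t, p (Sym.term t))
    (hnonterm : ∀ X, (∀ s ∈ G.rule X, p s) → p (Sym.nonterm X)) (s : Sym G.NT T) : p s := by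
  have h : ∀ X, p (Sym.nonterm X) := fun X =>
    G.isSLP.acyclic.induction (C := fun X => p (Sym.nonterm X)) X fun X ih =>
      hnonterm X fun s hs => match s with
        | Sym.nonterm Y => ih Y hs
        | Sym.term t => hterm t
  cases s with
  | nonterm X => exact h X
  | term t => exact hterm t

theorem reflTransGen_of_mem_symNodes (s : Sym G.NT T) :
    ∀ Z, s = Sym.nonterm Z → ∀ X ∈ G.symNodes s, Relation.ReflTransGen G.Child X Z := by
  induction s using sym_induction with
  | hterm t => intro Z h; cases h
  | hnonterm Z ih =>
    rintro _ ⟨⟩ X hX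
    rw [symNodes_nonterm, List.mem_cons, List.mem_flatMap] at hX
    rcases hX with rfl | ⟨s, hs, hX⟩
    · exact Relation.ReflTransGen.refl
    · cases s with
      | term t => simp at hX
      | nonterm Y => exact (ih _ hs Y rfl X hX).tail hs

theorem notMem_symNodes_of_mem_rule {X : G.NT} {s : Sym G.NT T} (hs : s ∈ G.rule X) :
    X ∉ G.symNodes s := by
  intro h
  cases s with
  | term t => simp at h
  | nonterm Y =>
    exact G.isSLP.acyclic.transGen.irrefl.irrefl X
      (Relation.TransGen.tail' (reflTransGen_of_mem_symNodes _ Y rfl X h) hs)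

/-- If the value of every node is at least the sum of the values of its children, then it is at
least the sum of the values of its descendants with a given label. -/
theorem count_symNodes_mul_le [DecidableEq G.NT] {f : Sym G.NT T → ℕ}
    (hf : ∀ Z, ((G.rule Z).map f).sum ≤ f (Sym.nonterm Z)) (X : G.NT) (s : Sym G.NT T) :
    (G.symNodes s).count X * f (Sym.nonterm X) ≤ f s := by
  induction s using sym_induction with
  | hterm t => simp
  | hnonterm Z ih =>
    by_cases hZ : Z = X
    -- By acyclicity no further `Z` occurs below this one, so the counted subtrees are disjoint.
    · subst hZ
      have h0 : ((G.rule Z).flatMap G.symNodes).count Z = 0 := by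
        rw [List.count_eq_zero, List.mem_flatMap]
        rintro ⟨s, hs, h⟩
        exact notMem_symNodes_of_mem_rule hs h
      rw [symNodes_nonterm, List.count_cons_self, h0, zero_add, one_mul]
    · refine le_trans ?_ (hf Z)
      rw [symNodes_nonterm, List.count_cons_of_ne hZ, List.count_flatMap, ← List.sum_map_mul_right]
      exact List.sum_le_sum ih

theorem occ_mul_le {f : Sym G.NT T → ℕ}
    (hf : ∀ Z, ((G.rule Z).map f).sum ≤ f (Sym.nonterm Z)) (X : G.NT) :
    G.occ X * f (Sym.nonterm X) ≤ f (Sym.nonterm G.start) := by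
  classical
  exact count_symNodes_mul_le hf X (Sym.nonterm G.start)

theorem occ_le_occ_of_child {X Y : G.NT} (h : G.Child Y X) : G.occ X ≤ G.occ Y := by
  classical
  have := occ_mul_le (G := G) (f := fun s => (G.symNodes s).count Y) (fun Z => by
    rw [symNodes_nonterm, List.count_cons, List.count_flatMap]
    exact Nat.le_add_right _ _) X
  have h1 : 1 ≤ (G.symNodes (Sym.nonterm X)).count Y := by
    rw [Nat.one_le_iff_ne_zero, ← Nat.pos_iff_ne_zero, List.count_pos_iff, symNodes_nonterm]
    refine List.mem_cons_of_mem _ (List.mem_flatMap.mpr ⟨_, h, ?_⟩)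
    rw [symNodes_nonterm]
    exact List.mem_cons_self
  refine (Nat.le_mul_of_pos_right _ h1).trans (this.trans (le_of_eq ?_))
  unfold occ
  congr 1

/-- Used twice: to keep separators out of repeated nonterminals, and to show that terminals below
occurring nonterminals occur in the string. -/
theorem occ_mul_count_le [DecidableEq T] (X : G.NT) (c : T) :
    G.occ X * (G.symExp (Sym.nonterm X)).count c ≤ G.expansion.count c :=
  occ_mul_le (f := fun s => (G.symExp s).count c) (fun Z => by
    rw [symExp_nonterm, List.count_flatMap]; rfl) X

theorem symFrontier_flatMap_symExp (keep : G.NT → Prop) (s : Sym G.NT T) :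
    (G.symFrontier keep s).flatMap G.symExp = G.symExp s := by
  induction s using sym_induction with
  | hterm t => simp
  | hnonterm X ih =>
    rw [symFrontier_nonterm]
    split_ifs
    · simp
    · rw [symExp_nonterm, List.flatMap_assoc]
      exact List.flatMap_congr ih

theorem keep_of_mem_symFrontier {keep : G.NT → Prop} {Y : G.NT} (s : Sym G.NT T)
    (h : Sym.nonterm Y ∈ G.symFrontier keep s) : keep Y := by
  induction s using sym_induction with
  | hterm t => simp at h
  | hnonterm X ih =>
    rw [symFrontier_nonterm] at h
    split_ifs at h with hk
    · rw [List.mem_singleton] at h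
      cases h
      exact hk
    · obtain ⟨s, hs, h⟩ := List.mem_flatMap.mp h
      exact ih s hs h

-- A tree with `m` inner nodes of at most two children each has at most `m + 1` leaves; here the
-- inner nodes are removed nodes and the leaves are the frontier.
open Classical in
theorem length_symFrontier_le (keep : G.NT → Prop) (s : Sym G.NT T) :
    (G.symFrontier keep s).length ≤ 1 + ((G.symNodes s).filter fun X => ¬ keep X).length := by
  induction s using sym_induction with
  | hterm t => simp
  | hnonterm X ih =>
    rw [symFrontier_nonterm, symNodes_nonterm]
    split_ifs with hk
    · simp
    · have h2 := G.isSLP.length_le_two X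
      rw [List.filter_cons_of_pos (by simpa using hk), List.length_cons]
      match hr : G.rule X with
      | [] => simp
      | [a] =>
        have := ih a (by simp [hr])
        simp only [List.flatMap_cons, List.flatMap_nil, List.append_nil] at this ⊢
        omega
      | [a, b] =>
        have h1 := ih a (by simp [hr])
        have h2 := ih b (by simp [hr])
        simp only [List.flatMap_cons, List.flatMap_nil, List.append_nil, List.length_append,
          List.filter_append] at h1 h2 ⊢
        omega
      | a :: b :: c :: l => simp [hr] at h2

/-- The removed nodes carry distinct labels, since a removed nonterminal occurs at most once; so the
number of removed nodes is at most the number of removed nonterminals. -/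
theorem length_frontier_le :
    (G.frontier fun X => 2 ≤ G.occ X).length ≤ 1 + Nat.card {X : G.NT // ¬ 2 ≤ G.occ X} := by
  classical
  have := G.finite
  have := Fintype.ofFinite G.NT
  refine (length_symFrontier_le (fun X => 2 ≤ G.occ X) (Sym.nonterm G.start)).trans ?_
  gcongr
  rw [Nat.card_eq_fintype_card, Fintype.card_subtype, ← List.toFinset_card_of_nodup]
  · refine Finset.card_le_card fun X hX => ?_
    simpa using (List.mem_filter.mp (List.mem_toFinset.mp hX)).2
  · rw [List.nodup_iff_count_le_one]
    intro X
    by_cases hX : 2 ≤ G.occ X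
    · rw [List.count_eq_zero_of_not_mem]
      · exact zero_le_one
      · intro h
        have := (List.mem_filter.mp h).2
        simp only [decide_eq_true_eq] at this
        exact this hX
    · rw [List.count_filter (by simpa using hX)]
      have : (G.symNodes (Sym.nonterm G.start)).count X = G.occ X := by
        unfold occ
        congr 1
      omega

end SLP

/-! ### Separators in the dictionary string -/

section DictionarySplit

variable {σ : Type u}

theorem flatten_markedBlocks_splitOnP (d : List (List σ)) :
    (markedBlocks d).flatten.splitOnP Sum.isRight = d.map (List.map Sum.inl) ++ [[]] := by
  suffices ∀ n, ((d.zipIdx n).map fun Bi =>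
      Bi.1.map Sum.inl ++ [(Sum.inr Bi.2 : σ ⊕ ℕ)]).flatten.splitOnP Sum.isRight =
        d.map (List.map Sum.inl) ++ [[]] from this 0
  induction d with
  | nil => simp
  | cons B d ih =>
    intro n
    rw [List.zipIdx_cons, List.map_cons, List.flatten_cons, List.append_assoc,
      List.singleton_append, List.splitOnP_append_cons_of_forall_mem (by simp) _ rfl, ih]
    rfl

theorem count_inr_flatten_markedBlocks_le [DecidableEq (σ ⊕ ℕ)] (d : List (List σ)) (j : ℕ) :
    (markedBlocks d).flatten.count (Sum.inr j) ≤ 1 := by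
  -- Numbering from `n` allows the induction to drop the first block; separators below `n` then do
  -- not occur at all.
  suffices ∀ n, ((d.zipIdx n).map fun Bi =>
      Bi.1.map Sum.inl ++ [(Sum.inr Bi.2 : σ ⊕ ℕ)]).flatten.count (Sum.inr j) ≤
        if n ≤ j then 1 else 0 from (this 0).trans (by simp)
  induction d with
  | nil => simp
  | cons B d ih =>
    intro n
    have := ih (n + 1)
    have h0 : (B.map Sum.inl).count (Sum.inr j : σ ⊕ ℕ) = 0 := by
      simp [List.count_eq_zero]
    rw [List.zipIdx_cons, List.map_cons, List.flatten_cons, List.count_append, List.count_append,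
      h0, List.count_singleton]
    split_ifs at this ⊢ with h1 h2 h3 h4 <;> (simp_all; try omega)

end DictionarySplit

/-! ### Correctness and size of the combined grammar -/

section Combine

variable {σ : Type u} {GD : SLP (σ ⊕ ℕ)} {GP : SLP (List σ)} {d : List (List σ)}

theorem dictSym_eq_some_nonterm {b : ℕ} {s : Sym GD.NT (σ ⊕ ℕ)} {y : CombinedNT GD GP b}
    (h : dictSym GD GP b s = some (Sym.nonterm y)) :
    ∃ X, ∃ hX : Remaining GD X, s = Sym.nonterm X ∧ y = Sum.inl ⟨X, hX⟩ := by
  match s with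
  | Sym.nonterm X =>
    simp only [dictSym] at h
    split_ifs at h with hX
    simp only [Option.some.injEq, Sym.nonterm.injEq] at h
    exact ⟨X, hX, rfl, h.symm⟩
  | Sym.term (Sum.inl a) => simp [dictSym] at h
  | Sym.term (Sum.inr a) => simp [dictSym] at h

theorem parseSym_eq_some_nonterm {s : Sym GP.NT (List σ)} {y : CombinedNT GD GP d.length}
    (h : parseSym GD GP d s = some (Sym.nonterm y)) :
    (∃ Y, ∃ hY : 1 ≤ GP.occ Y, s = Sym.nonterm Y ∧ y = Sum.inr (Sum.inr ⟨Y, hY⟩)) ∨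
      ∃ i, y = blockNT GD GP i := by
  match s with
  | Sym.nonterm Y =>
    simp only [parseSym] at h
    split_ifs at h with hY
    simp only [Option.some.injEq, Sym.nonterm.injEq] at h
    exact Or.inl ⟨Y, hY, rfl, h.symm⟩
  | Sym.term B =>
    simp only [parseSym] at h
    split_ifs at h with hB
    simp only [Option.some.injEq, Sym.nonterm.injEq] at h
    exact Or.inr ⟨_, h.symm⟩

/-- The right-hand sides of the combined grammar. -/
noncomputable def combineRule (y : CombinedNT GD GP d.length) :
    List (Sym (CombinedNT GD GP d.length) σ) :=
  (combine GD GP d).rule y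

theorem combineRule_dict (X : GD.NT) (hX : Remaining GD X) :
    combineRule (GP := GP) (d := d) (Sum.inl ⟨X, hX⟩) =
      (GD.rule X).filterMap (dictSym GD GP d.length) := rfl

theorem combineRule_block (i : Fin d.length) (k : Fin ((sublist GD i).length - 2 + 1)) :
    combineRule (GP := GP) (Sum.inr (Sum.inl ⟨i, k⟩)) =
      if h : (k : ℕ) + 1 < (sublist GD i).length - 2 + 1 then
        (((sublist GD i).drop k).filterMap (dictSym GD GP d.length)).take 1 ++
          [Sym.nonterm (Sum.inr (Sum.inl ⟨i, ⟨k + 1, h⟩⟩))]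
      else ((sublist GD i).drop k).filterMap (dictSym GD GP d.length) := rfl

theorem combineRule_parse (Y : GP.NT) (hY : 1 ≤ GP.occ Y) :
    combineRule (Sum.inr (Sum.inr ⟨Y, hY⟩)) = (GP.rule Y).filterMap (parseSym GD GP d) := rfl

theorem combine_acc_dict (X : GD.NT) (hX : Remaining GD X) :
    Acc (combine GD GP d).Child (Sum.inl ⟨X, hX⟩) := by
  induction X using GD.isSLP.acyclic.induction with
  | _ X ih =>
    refine Acc.intro _ fun y hy => ?_
    obtain ⟨s, hs, h⟩ := List.mem_filterMap.mp hy
    obtain ⟨X', hX', rfl, rfl⟩ := dictSym_eq_some_nonterm h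
    exact ih X' hs hX'

theorem combine_acc_block (i : Fin d.length) (k : Fin ((sublist GD i).length - 2 + 1)) :
    Acc (combine GD GP d).Child (Sum.inr (Sum.inl ⟨i, k⟩)) := by
  induction hn : (sublist GD i).length - 2 - k using Nat.strong_induction_on generalizing k with
  | _ n ih =>
    have hrest : ∀ y, Sym.nonterm y ∈
        ((sublist GD i).drop k).filterMap (dictSym GD GP d.length) →
          Acc (combine GD GP d).Child y := fun y hy => by
      obtain ⟨s, hs, h⟩ := List.mem_filterMap.mp hy
      obtain ⟨X', hX', rfl, rfl⟩ := dictSym_eq_some_nonterm h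
      exact combine_acc_dict X' hX'
    refine Acc.intro _ fun y hy => ?_
    change Sym.nonterm y ∈ combineRule _ at hy
    rw [combineRule_block] at hy
    split_ifs at hy with hk
    · rcases List.mem_append.mp hy with hy | hy
      · exact hrest y (List.mem_of_mem_take hy)
      · cases List.eq_of_mem_singleton hy
        exact ih _ (by subst hn; simp only []; omega) ⟨k + 1, hk⟩ rfl
    · exact hrest y hy

/-- References descend through three layers: parse nonterminals, sublist nonterminals with
increasing second index, dictionary nonterminals. Within the outer two layers acyclicity is
inherited from `GP` and `GD`. -/
theorem combine_acyclic : WellFounded (combine GD GP d).Child := by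
  refine ⟨fun y => ?_⟩
  match y with
  | Sum.inl ⟨X, hX⟩ => exact combine_acc_dict X hX
  | Sum.inr (Sum.inl ⟨i, k⟩) => exact combine_acc_block i k
  | Sum.inr (Sum.inr ⟨Y, hY⟩) =>
    induction Y using GP.isSLP.acyclic.induction with
    | _ Y ih =>
      refine Acc.intro _ fun y hy => ?_
      obtain ⟨s, hs, h⟩ := List.mem_filterMap.mp hy
      rcases parseSym_eq_some_nonterm h with ⟨Y', hY', rfl, rfl⟩ | ⟨i, rfl⟩
      · exact ih Y' hs hY'
      · exact combine_acc_block i 0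

/-- `GD` and `GP` are SLPs for the dictionary string of `d` and for a sequence of blocks
from `d`. -/
structure Compatible (GD : SLP (σ ⊕ ℕ)) (GP : SLP (List σ)) (d : List (List σ)) : Prop where
  expansion_dict : GD.expansion = (markedBlocks d).flatten
  mem_of_mem_expansion : ∀ B ∈ GP.expansion, B ∈ d
  ne_nil : ∀ B ∈ d, B ≠ []

namespace Compatible




/-- A nonterminal occurring twice would contribute its separator twice, but each separator occurs at
most once in `D`. -/
theorem isLeft_of_mem_symExp (H : Compatible GD GP d) {X : GD.NT} (hX : Remaining GD X) {c : σ ⊕ ℕ}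
    (hc : c ∈ GD.symExp (Sym.nonterm X)) : ∃ a, c = Sum.inl a := by
  have : DecidableEq (σ ⊕ ℕ) := Classical.decEq _
  cases c with
  | inl a => exact ⟨a, rfl⟩
  | inr j =>
    exfalso
    have h1 := GD.occ_mul_count_le X (Sum.inr j)
    have h2 := count_inr_flatten_markedBlocks_le d j
    have h3 := List.count_pos_iff.mpr hc
    rw [H.expansion_dict] at h1
    have h4 : 2 * 1 ≤ GD.occ X * (GD.symExp (Sym.nonterm X)).count (Sum.inr j) :=
      Nat.mul_le_mul hX h3
    omega

/-- A child occurs at least as often as its parent, so the remaining nonterminals are closed under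
descent and the `filterMap` in their rules discards nothing. -/
theorem isSome_dictSym_of_mem_rule (H : Compatible GD GP d) {X : GD.NT} (hX : Remaining GD X) {s : Sym GD.NT (σ ⊕ ℕ)}
    (hs : s ∈ GD.rule X) : (dictSym GD GP d.length s).isSome := by
  match s with
  | Sym.nonterm Y =>
    have : Remaining GD Y := le_trans hX (SLP.occ_le_occ_of_child hs)
    simp [dictSym, this]
  | Sym.term c =>
    obtain ⟨a, rfl⟩ := H.isLeft_of_mem_symExp hX (c := c) (by
      rw [SLP.symExp_nonterm, List.mem_flatMap]
      exact ⟨_, hs, by simp⟩)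
    rfl

theorem mem_frontier_of_mem_sublist {i : ℕ} {s : Sym GD.NT (σ ⊕ ℕ)} (hs : s ∈ sublist GD i) :
    s ∈ GD.frontier (Remaining GD) ∧ isSeparator s = false := by
  rw [sublist, List.getD_eq_getElem?_getD] at hs
  cases h : ((GD.frontier (Remaining GD)).splitOnP isSeparator)[i]? with
  | none => simp [h] at hs
  | some l =>
    rw [h] at hs
    exact mem_of_mem_splitOnP (List.mem_of_getElem? h) s hs

theorem isSome_dictSym_of_mem_sublist {i : ℕ} {s : Sym GD.NT (σ ⊕ ℕ)} (hs : s ∈ sublist GD i) :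
    (dictSym GD GP d.length s).isSome := by
  obtain ⟨h1, h2⟩ := mem_frontier_of_mem_sublist hs
  match s with
  | Sym.nonterm Y =>
    have : Remaining GD Y := SLP.keep_of_mem_symFrontier (Sym.nonterm GD.start) h1
    simp [dictSym, this]
  | Sym.term (Sum.inl a) => rfl
  | Sym.term (Sum.inr j) => cases h2

theorem splitOnP_frontier (H : Compatible GD GP d) :
    ((GD.frontier (Remaining GD)).splitOnP isSeparator).map (·.flatMap GD.symExp) =
      d.map (List.map Sum.inl) ++ [[]] := by
  rw [← flatten_markedBlocks_splitOnP, ← H.expansion_dict, ← SLP.symExp_start,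
    ← SLP.symFrontier_flatMap_symExp (Remaining GD), splitOnP_flatMap]
  · rfl
  · intro s _ hs
    match s with
    | Sym.term (Sum.inr j) => exact ⟨Sum.inr j, rfl, rfl⟩
    | Sym.term (Sum.inl a) => cases hs
    | Sym.nonterm Y => cases hs
  · intro s hmem hs c hc
    match s with
    | Sym.term (Sum.inr j) => cases hs
    | Sym.term (Sum.inl a) =>
      rw [SLP.symExp_term, List.mem_singleton] at hc
      subst hc
      rfl
    | Sym.nonterm Y =>
      obtain ⟨a, rfl⟩ := H.isLeft_of_mem_symExp (SLP.keep_of_mem_symFrontier _ hmem) hc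
      rfl

theorem sublist_flatMap_symExp (H : Compatible GD GP d) {i : ℕ} (hi : i < d.length) :
    (sublist GD i).flatMap GD.symExp = d[i].map Sum.inl := by
  have h := congrArg (fun L => L[i]?) H.splitOnP_frontier
  simp only [List.getElem?_map] at h
  rw [List.getElem?_append_left (by simpa using hi), List.getElem?_map,
    List.getElem?_eq_getElem hi] at h
  rw [sublist, List.getD_eq_getElem?_getD]
  cases hl : ((GD.frontier (Remaining GD)).splitOnP isSeparator)[i]? with
  | none => simp [hl] at h
  | some l => simpa [hl] using h

theorem length_sublist_pos (H : Compatible GD GP d) {i : ℕ} (hi : i < d.length) :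
    0 < (sublist GD i).length := by
  rw [List.length_pos_iff]
  intro h
  have := H.sublist_flatMap_symExp hi
  rw [h, List.flatMap_nil, eq_comm, List.map_eq_nil_iff] at this
  exact H.ne_nil _ (List.getElem_mem hi) this

/-- Nonterminals outside the parse tree may mention arbitrary strings, whence the condition on `Y`.
-/
theorem mem_of_mem_rule (H : Compatible GD GP d) {Y : GP.NT} (hY : 1 ≤ GP.occ Y) {B : List σ}
    (hB : Sym.term B ∈ GP.rule Y) : B ∈ d := by
  have : DecidableEq (List σ) := Classical.decEq _
  refine H.mem_of_mem_expansion B (List.count_pos_iff.mp ?_)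
  refine lt_of_lt_of_le ?_ (GP.occ_mul_count_le Y B)
  refine Nat.mul_pos hY (List.count_pos_iff.mpr ?_)
  rw [SLP.symExp_nonterm, List.mem_flatMap]
  exact ⟨_, hB, by simp⟩

theorem isSome_parseSym_of_mem_rule (H : Compatible GD GP d) {Y : GP.NT} (hY : 1 ≤ GP.occ Y)
    {s : Sym GP.NT (List σ)} (hs : s ∈ GP.rule Y) : (parseSym GD GP d s).isSome := by
  classical
  match s with
  | Sym.nonterm Y' =>
    have : 1 ≤ GP.occ Y' := le_trans hY (SLP.occ_le_occ_of_child hs)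
    simp [parseSym, this]
  | Sym.term B =>
    have := List.idxOf_lt_length_of_mem (H.mem_of_mem_rule hY hs)
    simp [parseSym, this]

theorem length_filterMap_sublist (i k : ℕ) :
    (((sublist GD i).drop k).filterMap (dictSym GD GP d.length)).length =
      (sublist GD i).length - k := by
  rw [length_filterMap_of_isSome fun s hs =>
    isSome_dictSym_of_mem_sublist (List.mem_of_mem_drop hs), List.length_drop]

theorem length_rule (H : Compatible GD GP d) (y : CombinedNT GD GP d.length) :
    1 ≤ (combineRule y).length ∧ (combineRule y).length ≤ 2 := by
  match y with
  | Sum.inl ⟨X, hX⟩ =>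
    rw [combineRule_dict, length_filterMap_of_isSome fun _ hs =>
      H.isSome_dictSym_of_mem_rule hX hs]
    exact ⟨GD.isSLP.one_le_length X, GD.isSLP.length_le_two X⟩
  | Sum.inr (Sum.inl ⟨i, k⟩) =>
    have hpos := H.length_sublist_pos i.2
    have hk := k.2
    have hlen := length_filterMap_sublist (GD := GD) (GP := GP) (d := d) i k
    rw [combineRule_block]
    split_ifs with h
    · rw [List.length_append, List.length_take, hlen]
      simp only [List.length_singleton]
      omega
    -- Here `k = ℓ - 2` in truncated subtraction: two symbols are left, or one if `ℓ = 1`.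
    · rw [hlen]
      omega
  | Sum.inr (Sum.inr ⟨Y, hY⟩) =>
    rw [combineRule_parse, length_filterMap_of_isSome fun _ hs =>
      H.isSome_parseSym_of_mem_rule hY hs]
    exact ⟨GP.isSLP.one_le_length Y, GP.isSLP.length_le_two Y⟩

/-- The combined grammar as an SLP. -/
noncomputable def slp (H : Compatible GD GP d) : SLP σ where
  toGrammar := combine GD GP d
  isSLP := ⟨combine_acyclic, fun X => (H.length_rule X).1, fun X => (H.length_rule X).2⟩

/-- The string generated from a symbol of the combined grammar. -/
noncomputable def exp (H : Compatible GD GP d) (s : Sym (CombinedNT GD GP d.length) σ) : List σ :=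
  H.slp.symExp s

theorem exp_term (H : Compatible GD GP d) (a : σ) : H.exp (Sym.term a) = [a] := rfl

theorem exp_nonterm (H : Compatible GD GP d) (y : CombinedNT GD GP d.length) :
    H.exp (Sym.nonterm y) = (combineRule y).flatMap H.exp :=
  SLP.symExp_nonterm H.slp y

theorem map_exp_dictSym (H : Compatible GD GP d) (s : Sym GD.NT (σ ⊕ ℕ))
    (s' : Sym (CombinedNT GD GP d.length) σ) (h : dictSym GD GP d.length s = some s') :
    (H.exp s').map Sum.inl = GD.symExp s := by
  induction s using SLP.sym_induction generalizing s' with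
  | hterm t =>
    cases t with
    | inl a =>
      cases h
      rw [exp_term]
      rfl
    | inr j => cases h
  | hnonterm X ih =>
    simp only [dictSym] at h
    split_ifs at h with hX
    cases h
    rw [exp_nonterm, combineRule_dict, List.map_flatMap, SLP.symExp_nonterm]
    refine flatMap_filterMap_eq fun s hs => ?_
    obtain ⟨b, hb⟩ := Option.isSome_iff_exists.mp
      (H.isSome_dictSym_of_mem_rule (GP := GP) (d := d) hX hs)
    exact ⟨b, hb, ih s hs b hb⟩

theorem map_flatMap_filterMap_dictSym (H : Compatible GD GP d) {l : List (Sym GD.NT (σ ⊕ ℕ))}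
    (hl : ∀ s ∈ l, (dictSym GD GP d.length s).isSome) :
    ((l.filterMap (dictSym GD GP d.length)).flatMap H.exp).map Sum.inl =
      l.flatMap GD.symExp := by
  rw [List.map_flatMap]
  refine flatMap_filterMap_eq fun s hs => ?_
  obtain ⟨b, hb⟩ := Option.isSome_iff_exists.mp (hl s hs)
  exact ⟨b, hb, H.map_exp_dictSym s b hb⟩

theorem map_exp_block (H : Compatible GD GP d) (i : Fin d.length)
    (k : Fin ((sublist GD i).length - 2 + 1)) :
    (H.exp (Sym.nonterm (Sum.inr (Sum.inl ⟨i, k⟩) : CombinedNT GD GP d.length))).map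
      Sum.inl = ((sublist GD i).drop k).flatMap GD.symExp := by
  induction hn : (sublist GD i).length - 2 - k using Nat.strong_induction_on generalizing k with
  | _ n ih =>
    have hsome : ∀ s ∈ (sublist GD i).drop k, (dictSym GD GP d.length s).isSome := fun s hs =>
      isSome_dictSym_of_mem_sublist (List.mem_of_mem_drop hs)
    rw [exp_nonterm, combineRule_block]
    split_ifs with h
    · have hk : (k : ℕ) < (sublist GD i).length := by omega
      rw [List.drop_eq_getElem_cons hk] at hsome ⊢
      obtain ⟨b, hb⟩ := Option.isSome_iff_exists.mp (hsome _ List.mem_cons_self)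
      rw [List.filterMap_cons_some hb, List.take_succ_cons, List.take_zero, List.singleton_append,
        List.flatMap_cons, List.flatMap_cons, List.flatMap_nil, List.append_nil, List.map_append,
        H.map_exp_dictSym _ b hb, ih _ (by subst hn; simp only []; omega) ⟨k + 1, h⟩ rfl,
        List.flatMap_cons]
    · exact H.map_flatMap_filterMap_dictSym hsome

theorem exp_blockNT (H : Compatible GD GP d) (i : Fin d.length) :
    H.exp (Sym.nonterm (blockNT GD GP i)) = d[i] := by
  have h := H.map_exp_block i 0
  rw [Fin.val_zero, List.drop_zero, H.sublist_flatMap_symExp i.2] at h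
  exact List.map_injective_iff.mpr Sum.inl_injective h

theorem exp_parseSym (H : Compatible GD GP d) (s : Sym GP.NT (List σ))
    (s' : Sym (CombinedNT GD GP d.length) σ) (h : parseSym GD GP d s = some s') :
    H.exp s' = (GP.symExp s).flatten := by
  induction s using SLP.sym_induction generalizing s' with
  | hterm B =>
    simp only [parseSym] at h
    split_ifs at h with hB
    cases h
    rw [exp_blockNT]
    simp
  | hnonterm Y ih =>
    simp only [parseSym] at h
    split_ifs at h with hY
    cases h
    rw [exp_nonterm, combineRule_parse, SLP.symExp_nonterm, List.flatten_eq_flatMap,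
      List.flatMap_assoc]
    refine flatMap_filterMap_eq fun s hs => ?_
    obtain ⟨b, hb⟩ := Option.isSome_iff_exists.mp
      (H.isSome_parseSym_of_mem_rule (GD := GD) (d := d) hY hs)
    exact ⟨b, hb, by rw [ih s hs b hb, List.flatten_eq_flatMap]⟩

theorem expansion_slp (H : Compatible GD GP d) : H.slp.expansion = GP.expansion.flatten :=
  H.exp_parseSym (Sym.nonterm GP.start) _ (dif_pos GP.one_le_occ_start)

/-- Sublists are nonempty, so each needs at most as many new rules as it has elements; their total
length is at most that of the frontier, which is at most 1 plus the number of deleted nonterminals.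
Remaining and deleted nonterminals together make up `GD`. -/
theorem numRules_slp_le (H : Compatible GD GP d) :
    H.slp.numRules ≤ 1 + GD.numRules + GP.numRules := by
  have := GD.finite
  have := GP.finite
  have h1 : H.slp.numRules = Nat.card {X : GD.NT // Remaining GD X} +
      (∑ i : Fin d.length, ((sublist GD i).length - 2 + 1) +
        Nat.card {Y : GP.NT // 1 ≤ GP.occ Y}) := by
    change Nat.card (CombinedNT GD GP d.length) = _
    rw [Nat.card_sum, Nat.card_sum, Nat.card_sigma]
    simp
  have h2 : ∑ i : Fin d.length, ((sublist GD i).length - 2 + 1) ≤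
      (GD.frontier (Remaining GD)).length := by
    refine le_trans (Finset.sum_le_sum (g := fun i : Fin d.length => (sublist GD i).length)
      fun i _ => ?_) ?_
    · have := H.length_sublist_pos i.2
      omega
    · rw [Fin.sum_univ_eq_sum_range (fun i => (sublist GD i).length)]
      exact (sum_length_getD_le _ _).trans (sum_length_splitOnP_le _ _)
  have h3 : (GD.frontier (Remaining GD)).length ≤
      1 + Nat.card {X : GD.NT // ¬ Remaining GD X} := SLP.length_frontier_le
  have h4 : Nat.card {X : GD.NT // Remaining GD X} + Nat.card {X : GD.NT // ¬ Remaining GD X} =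
      GD.numRules := by
    classical
    rw [← Nat.card_sum]
    exact Nat.card_congr (Equiv.sumCompl (Remaining GD))
  have h5 : Nat.card {Y : GP.NT // 1 ≤ GP.occ Y} ≤ GP.numRules :=
    Nat.card_le_card_of_injective _ Subtype.val_injective
  omega

end Compatible

theorem Grammar.numRules_pos {T : Type u} (G : Grammar T) : 0 < G.numRules := by
  have := G.finite
  have : Nonempty G.NT := ⟨G.start⟩
  exact Nat.card_pos

end Combine

/-! ### Assembling the bound -/

theorem rpair_compatible (A : SLPConstruction.{u}) {σ : Type u} (R : Rsync σ) (S : List σ)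
    (hS : S ≠ []) :
    Compatible (A.build (R.dictString S) (R.dictString_ne_nil hS))
      (A.build (R.parse S) (R.parse_ne_nil hS)) (R.dictionary S) where
  expansion_dict := by rw [A.expansion_build, R.dictString_eq]
  mem_of_mem_expansion B hB := by
    rw [A.expansion_build] at hB
    exact R.mem_dictionary.mpr hB
  ne_nil B hB := R.ne_nil_of_mem_parse (R.mem_dictionary.mp hB)

end Rpair

theorem mainTheorem1 :
    ∃ C : ℝ, 0 < C ∧
      ∀ {σ : Type u} (R : Rpair.Rsync σ) (S : List σ) (hS : S ≠ []),
        R.ContextTriggered S →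
        ∀ (A : Rpair.SLPConstruction.{u}) (α : ℝ),
          ((A.build (R.dictString S) (R.dictString_ne_nil hS)).numRules : ℝ)
              ≤ α * Rpair.numPhrases (R.dictString S) →
          ((A.build (R.parse S) (R.parse_ne_nil hS)).numRules : ℝ)
              ≤ α * Rpair.numPhrases (R.parse S) →
          ∃ G : Rpair.SLP σ,
            G.toGrammar = Rpair.rpair A R S hS ∧
            G.expansion = S ∧
            (G.numRules : ℝ) ≤ C * (α * Rpair.numPhrases S) := by
  -- The total is at most `2α(6z + 6) + α(4z + 6) ≤ 34αz`, so 40 leaves slack.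
  refine ⟨40, by norm_num, ?_⟩
  intro σ R S hS hct A α hD hP
  have H := Rpair.rpair_compatible A R S hS
  refine ⟨H.slp, rfl, ?_, ?_⟩
  · rw [H.expansion_slp, A.expansion_build, R.flatten_parse]
  have hle : (H.slp.numRules : ℝ) ≤ 1 + (A.build (R.dictString S) (R.dictString_ne_nil hS)).numRules
      + (A.build (R.parse S) (R.parse_ne_nil hS)).numRules := by
    exact_mod_cast H.numRules_slp_le
  -- The additive 1 is absorbed by counting the SLP for `D` a second time.
  have hone : (1 : ℝ) ≤ (A.build (R.dictString S) (R.dictString_ne_nil hS)).numRules := by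
    exact_mod_cast (A.build (R.dictString S) (R.dictString_ne_nil hS)).numRules_pos
  have hz : (1 : ℝ) ≤ Rpair.numPhrases S := by exact_mod_cast Rpair.numPhrases_pos hS
  have hzD : (Rpair.numPhrases (R.dictString S) : ℝ) ≤ 6 * Rpair.numPhrases S + 6 := by
    exact_mod_cast hct.numPhrases_dictString_le
  have hzP : (Rpair.numPhrases (R.parse S) : ℝ) ≤ 4 * Rpair.numPhrases S + 6 := by
    exact_mod_cast hct.numPhrases_parse_le
  -- A negative `α` would leave no room for the at least one rule of the SLP for `D`.
  have hα : 0 ≤ α := by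
    by_contra hneg
    have := mul_nonpos_of_nonpos_of_nonneg (not_le.mp hneg).le
      (Nat.cast_nonneg (α := ℝ) (Rpair.numPhrases (R.dictString S)))
    linarith
  have h1 := mul_le_mul_of_nonneg_left hzD hα
  have h2 := mul_le_mul_of_nonneg_left hzP hα
  have h3 := mul_le_mul_of_nonneg_left hz hα
  linarith
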